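/- A permutation of length $n\ge 0$ is a bijection $\pi$ of $\{1,\dots,n\}$, regarded as the set of its elements $(i,\pi(i))$; $S_n$ is the set of permutations of length $n$. The pattern of a set of $k$ elements of $\pi$ is the permutation of length $k$ whose elements are in the same relative order, by position and by value. A permutation $\pi$ avoids $\beta$ if no set of elements of $\pi$ has pattern $\beta$, and $\mathrm{Av}(B)$ is the set of all permutations that avoid every $\beta\in B$; $321$ is the decreasing permutation of length $3$. The (upper) growth rate of a set $\mathcal C$ of permutations is $$s(\mathcal C)=\limsup_{n\to\infty}|\mathcal C\cap S_n|^{1/n}\in[0,\infty].$$ An element of $\pi$ is an articulation point if all elements of $\pi$ preceding it are smaller and all elements of $\pi$ following it are larger. Let $\mathrm{red}(\pi)$ be the pattern of the set of all elements of $\pi$ that are not articulation points (possibly the empty permutation), and $\mathrm{red}(X)=\{\mathrm{red}(\pi):\pi\in X\}$. Removing an articulation point from $\pi$ means passing to the pattern of all the other elements; adding an articulation point is the inverse operation. Theorem 3.1. For every finite set $X$ of permutations, $$s\bigl(\mathrm{Av}(321)\cap \mathrm{Av}(X)\bigr)=s\bigl(\mathrm{Av}(321)\cap \mathrm{Av}(\mathrm{red}(X))\bigr).$$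 Consequently articulation points can be added or removed anywhere in basis elements without changing the growth rate: if $X$ and $Y$ are finite sets of permutations such that every element of each of them can be turned into some element of the other by a finite (possibly empty) sequence of additions and removals of articulation points, then $$s\bigl(\mathrm{Av}(321)\cap \mathrm{Av}(X)\bigr)=s\bigl(\mathrm{Av}(321)\cap \mathrm{Av}(Y)\bigr).$$ -/

import Mathlib

open scoped ENNReal

namespace PermPattern

/-- A permutation of finite length: a length `n` and a bijection of `Fin n` (positions) onto `Fin n`
(values). The empty permutation is included. -/
abbrev FinPerm : Type := Σ n : ℕ, Equiv.Perm (Fin n)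

/-- `Involves α π`: there is an embedding of `α` in `π`, that is, a map from the elements of `α`
to those of `π` which respects both the order of positions and the order of values. -/
def Involves (α π : FinPerm) : Prop :=
  ∃ f : Fin α.1 ↪o Fin π.1, ∀ i j, α.2 i < α.2 j ↔ π.2 (f i) < π.2 (f j)

/-- `Av B`: the class of all permutations that involve no element of `B`. -/
def Av (B : Set FinPerm) : Set FinPerm := {π | ∀ β ∈ B, ¬ Involves β π}

/-- The decreasing permutation `k ⋯ 2 1`. -/
def decreasing (k : ℕ) : FinPerm := ⟨k, Fin.revPerm⟩

/-- The (upper) growth rate `limsup |C ∩ Sₙ| ^ (1/n)`, as an extended nonnegative real. -/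
noncomputable def growthRate (C : Set FinPerm) : ℝ≥0∞ :=
  Filter.limsup
    (fun n : ℕ => (({π : Equiv.Perm (Fin n) | (⟨n, π⟩ : FinPerm) ∈ C}.ncard : ℕ) : ℝ≥0∞) ^
      (1 / (n : ℝ)))
    Filter.atTop

/-- The pattern of a set `S` of elements (given by their positions) of `π`: the permutation of
length `|S|` that is order isomorphic to `π` restricted to `S`. -/
def patternOn (π : FinPerm) (S : Finset (Fin π.1)) : FinPerm :=
  ⟨S.card,
    ((S.orderIsoOfFin rfl).toEquiv.trans
      (π.2.subtypeEquiv (q := fun b => b ∈ S.map π.2.toEmbedding) (fun a => by simp))).trans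
      ((S.map π.2.toEmbedding).orderIsoOfFin (Finset.card_map _)).symm.toEquiv⟩

/-- The pattern of `S` is ordered as the elements of `π` at the positions in `S` are. -/
theorem patternOn_lt_iff (π : FinPerm) (S : Finset (Fin π.1)) (i j : Fin S.card) :
    (patternOn π S).2 i < (patternOn π S).2 j ↔
      π.2 (S.orderEmbOfFin rfl i) < π.2 (S.orderEmbOfFin rfl j) := by
  exact ((S.map π.2.toEmbedding).orderIsoOfFin (Finset.card_map _)).symm.lt_iff_lt

/-- The element of `π` at position `i` is an articulation point: every preceding element is smaller
and every following element is larger. Equivalently `π = α ⊕ 1 ⊕ β`, this element being the `1`. -/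
def IsArticulationPoint (π : FinPerm) (i : Fin π.1) : Prop :=
  ∀ j, (j < i → π.2 j < π.2 i) ∧ (i < j → π.2 i < π.2 j)

instance (π : FinPerm) : DecidablePred (IsArticulationPoint π) :=
  fun i => inferInstanceAs
    (Decidable (∀ j, (j < i → π.2 j < π.2 i) ∧ (i < j → π.2 i < π.2 j)))

/-- The rigid reduction: remove all articulation points. -/
def red (π : FinPerm) : FinPerm :=
  patternOn π (Finset.univ.filter fun i => ¬ IsArticulationPoint π i)

/-- `σ` is obtained from `π` by removing one articulation point (equivalently, `π` is obtained from
`σ` by adding one). -/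
def RemovesArticulationPoint (π σ : FinPerm) : Prop :=
  ∃ i, IsArticulationPoint π i ∧ σ = patternOn π {i}ᶜ

/-- `σ` is obtained from `π` by a finite (possibly empty) sequence of additions and removals of
single articulation points. -/
def ArticulationEquiv : FinPerm → FinPerm → Prop := Relation.EqvGen RemovesArticulationPoint

end PermPattern

/-! It suffices to replace, in a basis `insert β C`, the permutation `β` by `β⁻`, obtained by
deleting one articulation point `a₀` (`growthRate_insert_patternOn_compl`). Avoiding `β⁻` implies
avoiding `β`, so one inequality is an inclusion of classes. If `β` contains 321, so does `β⁻`, and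
both conditions are void. Otherwise every permutation avoiding 321, `β` and `C` is coloured with
boundedly many colours so that each class has at most one element or avoids `β⁻`, and the colours
change boundedly often both along positions and along values. Such a merge is determined by
polynomially many colour words and the patterns of the classes, so merging does not raise the growth
rate (`growthRate_le_of_isBoundedMerge`).

The colouring (`exists_coloring`): for each distribution of `β⁻` over the two increasing chains,
take the least copy `f` of `β⁻`. In another copy `g` of that type, no element of the part below `a₀`
lies to the upper right of the corresponding part of `f`: it could serve as `a₀` between the lower
part of `f` and the upper part of `g`. Hence, unless `g` shares one of two extreme elements with
`f`, it has elements to the upper left and to the lower right of a fixed corner. A colour separating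
these two quadrants prevents `g` from being monochromatic.

The separating colour (`exists_separation`): walk between the chains, alternately by position and by
value, starting in the upper left quadrant; each step costs one line. If a walk soon meets the
zigzag from the lower right quadrant, the lines form a cut. If none does, the walks build a large
descending staircase, which contains every small 321-avoiding permutation (`exists_staircase`), in
particular `β` (`exists_cut`). A cut on the lower left of the corner and one on its upper right
combine to the colour. -/

namespace PermPattern

/-! ### Drawing 321-avoiding permutations on two parallel lines -/

/-- Scaled two-line coordinates of a finite set `S` of points: a point `x` on the upper line has
coordinates `(T x, T x + W)` and a point on the lower line `(T x + W, T x)`, up to order. -/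
structure TwoLineCoords {Y : Type*} (p v : Y → ℤ) (U : Y → Prop) (S : Finset Y)
    (T : Y → ℤ) (W : ℤ) : Prop where
  pos : 0 < W
  upper : ∀ x ∈ S, ∀ y ∈ S, U x → U y → p x < p y → T x < T y
  lower : ∀ x ∈ S, ∀ y ∈ S, ¬ U x → ¬ U y → p x < p y → T x < T y
  p_lt : ∀ x ∈ S, ∀ y ∈ S, U x → ¬ U y → p x < p y → T x < T y + W
  p_gt : ∀ x ∈ S, ∀ y ∈ S, U x → ¬ U y → p y < p x → T y + W < T x
  v_lt : ∀ x ∈ S, ∀ y ∈ S, U x → ¬ U y → v x < v y → T x + W < T y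
  v_gt : ∀ x ∈ S, ∀ y ∈ S, U x → ¬ U y → v y < v x → T y < T x + W
  -- This keeps room for later lower points `l`, which may have to be to the right of `x'` and below
  -- `x`, so that `T x' - W < T l < T x + W`. Once a lower point above `x` has occurred, all later
  -- lower points are above `x` too.
  spread : ∀ x ∈ S, ∀ x' ∈ S, U x → U x' → p x < p x' →
    (∀ l ∈ S, ¬ U l → p l < p x' → v l < v x) → T x' < T x + 2 * W
  -- The cells of length `W` will be the columns of a staircase; even cells hold upper points and
  -- odd cells lower ones.
  upper_even : ∀ x ∈ S, U x → T x / W % 2 = 0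
  lower_odd : ∀ x ∈ S, ¬ U x → T x / W % 2 = 1
  upper_nonneg : ∀ x ∈ S, U x → 0 ≤ T x
  lower_ge : ∀ x ∈ S, ¬ U x → - W ≤ T x
  lt_top : ∀ x ∈ S, T x < (S.card + 1) * W

theorem two_mul_add_one_ediv (M W : ℤ) : (2 * M + 1) / (2 * W) = M / W := by
  have h1 : (2 * M + 1) / 2 = M := by omega
  rw [← Int.ediv_ediv_of_nonneg (by norm_num : (0:ℤ) ≤ 2), h1]

theorem add_ediv_self (M W : ℤ) (hW : 0 < W) : (M + W) / W = M / W + 1 :=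
  Int.add_ediv_of_dvd_right (dvd_refl W) |>.trans (by rw [Int.ediv_self hW.ne'])

theorem sub_ediv_self (M W : ℤ) (hW : 0 < W) : (M - W) / W = M / W - 1 := by
  have := add_ediv_self (M - W) W hW
  rw [sub_add_cancel] at this; omega

section Insertion
variable {Y : Type*} {p v : Y → ℤ} {U : Y → Prop} {S : Finset Y} {T : Y → ℤ} {W : ℤ}

-- The new point is rightmost and topmost, so only lower bounds constrain it. It goes immediately
-- after the greatest of them, `M`; doubling the scale makes room at `2 * M + 1` without leaving the
-- cell of `M`.
open Classical in
theorem TwoLineCoords.insert_upper (hp : Function.Injective p) (h : TwoLineCoords p v U S T W) {a : Y} (ha : a ∉ S)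
    (hpa : ∀ x ∈ S, p x < p a) (hUa : U a) (hva : ∀ x ∈ S, v x < v a) :
    ∃ T' W', TwoLineCoords p v U (insert a S) T' W' := by
  have hW := h.pos
  obtain ⟨M, hM0, hMU, hML, hM⟩ : ∃ M : ℤ, 0 ≤ M ∧ (∀ x ∈ S, U x → T x ≤ M) ∧
      (∀ x ∈ S, ¬ U x → T x + W ≤ M) ∧
      (M = 0 ∨ (∃ x ∈ S, U x ∧ M = T x) ∨ ∃ x ∈ S, ¬ U x ∧ M = T x + W) := by
    let B : Finset ℤ := insert 0 (S.image fun x => if U x then T x else T x + W)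
    obtain ⟨M, hM, hmax⟩ := B.exists_max_image id ⟨0, by simp [B]⟩
    refine ⟨M, hmax 0 (by simp [B]), fun x hx hUx => ?_, fun x hx hUx => ?_, ?_⟩
    · exact hmax _ (by simp only [B, Finset.mem_insert, Finset.mem_image]
                       exact Or.inr ⟨x, hx, by simp [hUx]⟩)
    · exact hmax _ (by simp only [B, Finset.mem_insert, Finset.mem_image]
                       exact Or.inr ⟨x, hx, by simp [hUx]⟩)
    · simp only [B, Finset.mem_insert, Finset.mem_image] at hM
      rcases hM with rfl | ⟨x, hx, rfl⟩
      · exact Or.inl rfl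
      · by_cases hUx : U x
        · exact Or.inr (Or.inl ⟨x, hx, hUx, by simp [hUx]⟩)
        · exact Or.inr (Or.inr ⟨x, hx, hUx, by simp [hUx]⟩)
  have hne : ∀ x ∈ S, x ≠ a := fun x hx hxa => ha (hxa ▸ hx)
  have hpar : M / W % 2 = 0 := by
    rcases hM with rfl | ⟨x, hx, hUx, rfl⟩ | ⟨x, hx, hUx, rfl⟩
    · simp
    · exact h.upper_even x hx hUx
    · have := h.lower_odd x hx hUx
      rw [add_ediv_self _ _ hW]; omega
  have hMtop : M < (S.card + 2) * W := by
    rcases hM with rfl | ⟨x, hx, hUx, rfl⟩ | ⟨x, hx, hUx, rfl⟩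
    · positivity
    · have := h.lt_top x hx; linarith
    · have := h.lt_top x hx; linarith
  let T' : Y → ℤ := fun x => if x = a then 2 * M + 1 else 2 * T x
  have hTa : T' a = 2 * M + 1 := by simp [T']
  have hTS : ∀ x ∈ S, T' x = 2 * T x := fun x hx => by simp [T', hne x hx]
  refine ⟨T', 2 * W, ⟨by omega, ?_, ?_, ?_, ?_, ?_, ?_, ?_, ?_, ?_, ?_, ?_, ?_⟩⟩
  · simp only [Finset.forall_mem_insert]
    refine ⟨⟨by simp, fun y hy _ _ hlt => ?_⟩, fun x hx => ⟨fun hUx _ _ => ?_, fun y hy => ?_⟩⟩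
    · have := hpa y hy; omega
    · have := hMU x hx hUx; rw [hTa, hTS x hx]; omega
    · rw [hTS x hx, hTS y hy]
      intro h1 h2 h3; have := h.upper x hx y hy h1 h2 h3; omega
  · simp only [Finset.forall_mem_insert]
    refine ⟨⟨by simp, fun y hy h1 => absurd hUa h1⟩,
      fun x hx => ⟨fun _ h1 => absurd hUa h1, fun y hy => ?_⟩⟩
    rw [hTS x hx, hTS y hy]
    intro h1 h2 h3; have := h.lower x hx y hy h1 h2 h3; omega
  · simp only [Finset.forall_mem_insert]
    refine ⟨⟨by simp, fun y hy h1 _ hlt => ?_⟩,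
      fun x hx => ⟨fun _ h1 => absurd hUa h1, fun y hy => ?_⟩⟩
    · have := hpa y hy; omega
    · rw [hTS x hx, hTS y hy]
      intro h1 h2 h3; have := h.p_lt x hx y hy h1 h2 h3; omega
  · simp only [Finset.forall_mem_insert]
    refine ⟨⟨by simp, fun y hy _ h1 hlt => ?_⟩,
      fun x hx => ⟨fun _ h1 => absurd hUa h1, fun y hy => ?_⟩⟩
    · have := hML y hy h1; rw [hTa, hTS y hy]; omega
    · rw [hTS x hx, hTS y hy]
      intro h1 h2 h3; have := h.p_gt x hx y hy h1 h2 h3; omega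
  · simp only [Finset.forall_mem_insert]
    refine ⟨⟨by simp, fun y hy _ h1 hlt => ?_⟩,
      fun x hx => ⟨fun _ h1 => absurd hUa h1, fun y hy => ?_⟩⟩
    · have := hva y hy; omega
    · rw [hTS x hx, hTS y hy]
      intro h1 h2 h3; have := h.v_lt x hx y hy h1 h2 h3; omega
  · simp only [Finset.forall_mem_insert]
    refine ⟨⟨by simp, fun y hy _ h1 hlt => ?_⟩,
      fun x hx => ⟨fun _ h1 => absurd hUa h1, fun y hy => ?_⟩⟩
    · have := hML y hy h1; rw [hTa, hTS y hy]; omega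
    · rw [hTS x hx, hTS y hy]
      intro h1 h2 h3; have := h.v_gt x hx y hy h1 h2 h3; omega
  · simp only [Finset.forall_mem_insert]
    refine ⟨⟨by simp, fun y hy h1 _ hlt => ?_⟩,
      fun x hx => ⟨fun hUx _ hlt hl => ?_, fun y hy => ?_⟩⟩
    · have := hpa y hy; omega
    · rw [hTa, hTS x hx]
      have : M < T x + 2 * W := by
        rcases hM with rfl | ⟨z, hz, hUz, rfl⟩ | ⟨z, hz, hUz, rfl⟩
        · have := h.upper_nonneg x hx hUx; omega
        · rcases lt_or_ge (p x) (p z) with hxz | hxz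
          · exact h.spread x hx z hz hUx hUz hxz
              fun l hlS hUl hlz => hl.2 l hlS hUl (hpa l hlS)
          · rcases hxz.lt_or_eq with h1 | h1
            · have := h.upper z hz x hx hUz hUx h1; omega
            · rw [hp h1]; omega
        · have := h.v_gt x hx z hz hUx hUz (hl.2 z hz hUz (hpa z hz)); omega
      omega
    · rw [hTS x hx, hTS y hy]
      intro h1 h2 h3 h4; have := h.spread x hx y hy h1 h2 h3 h4.2; omega
  · simp only [Finset.forall_mem_insert]
    refine ⟨fun _ => ?_, fun x hx hUx => ?_⟩
    · rw [hTa, two_mul_add_one_ediv]; exact hpar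
    · rw [hTS x hx, Int.mul_ediv_mul_of_pos _ _ (by norm_num)]; exact h.upper_even x hx hUx
  · simp only [Finset.forall_mem_insert]
    refine ⟨fun h1 => absurd hUa h1, fun x hx hUx => ?_⟩
    rw [hTS x hx, Int.mul_ediv_mul_of_pos _ _ (by norm_num)]; exact h.lower_odd x hx hUx
  · simp only [Finset.forall_mem_insert]
    refine ⟨fun _ => by omega, fun x hx hUx => ?_⟩
    have := h.upper_nonneg x hx hUx; rw [hTS x hx]; omega
  · simp only [Finset.forall_mem_insert]
    refine ⟨fun h1 => absurd hUa h1, fun x hx hUx => ?_⟩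
    have := h.lower_ge x hx hUx; rw [hTS x hx]; omega
  · simp only [Finset.forall_mem_insert]
    rw [Finset.card_insert_of_notMem ha]; push_cast
    refine ⟨by rw [hTa]; linarith, fun x hx => ?_⟩
    have := h.lt_top x hx; rw [hTS x hx]; linarith

-- Again the new point goes just after its greatest lower bound `M`, but now the upper points above
-- `a` also bound it from above. The bounds are compatible by `hkey`, which is where `spread` is
-- needed.
open Classical in
theorem TwoLineCoords.insert_lower (hp : Function.Injective p) (h : TwoLineCoords p v U S T W)
    {a : Y} (ha : a ∉ S) (hpa : ∀ x ∈ S, p x < p a) (hUa : ¬ U a)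
    (hUv : ∀ x ∈ S, ∀ y ∈ S, U x → U y → p x < p y → v x < v y)
    (hLv : ∀ x ∈ S, ¬ U x → v x < v a) (hex : ∃ x ∈ S, U x ∧ v a < v x) :
    ∃ T' W', TwoLineCoords p v U (insert a S) T' W' := by
  have hW := h.pos
  obtain ⟨u, huS, hUu, hau⟩ := hex
  obtain ⟨M, hMU, hML, hMb, hM⟩ : ∃ M : ℤ, (∀ x ∈ S, U x → T x - W ≤ M) ∧
      (∀ x ∈ S, ¬ U x → T x ≤ M) ∧ (∀ x ∈ S, U x → v x < v a → T x + W ≤ M) ∧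
      ((∃ x ∈ S, U x ∧ M = T x - W) ∨ (∃ x ∈ S, ¬ U x ∧ M = T x) ∨
        ∃ x ∈ S, U x ∧ v x < v a ∧ M = T x + W) := by
    let F : Y → ℤ := fun x => if U x then (if v x < v a then T x + W else T x - W) else T x
    obtain ⟨x, hx, hmax⟩ := S.exists_max_image F ⟨u, huS⟩
    refine ⟨F x, fun y hy hUy => ?_, fun y hy hUy => ?_, fun y hy hUy hv => ?_, ?_⟩
    · have := hmax y hy
      refine le_trans ?_ this
      simp only [F, hUy, if_true]
      split_ifs <;> omega
    · refine le_trans ?_ (hmax y hy)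
      simp [F, hUy]
    · refine le_trans ?_ (hmax y hy)
      simp [F, hUy, hv]
    · by_cases hUx : U x
      · by_cases hv : v x < v a
        · exact Or.inr (Or.inr ⟨x, hx, hUx, hv, by simp [F, hUx, hv]⟩)
        · exact Or.inl ⟨x, hx, hUx, by simp [F, hUx, hv]⟩
      · exact Or.inr (Or.inl ⟨x, hx, hUx, by simp [F, hUx]⟩)
  have hne : ∀ x ∈ S, x ≠ a := fun x hx hxa => ha (hxa ▸ hx)
  have hpar : M / W % 2 = 1 := by
    rcases hM with ⟨x, hx, hUx, rfl⟩ | ⟨x, hx, hUx, rfl⟩ | ⟨x, hx, hUx, -, rfl⟩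
    · have := h.upper_even x hx hUx
      rw [sub_ediv_self _ _ hW]; omega
    · exact h.lower_odd x hx hUx
    · have := h.upper_even x hx hUx
      rw [add_ediv_self _ _ hW]; omega
  have hMtop : M < (S.card + 2) * W := by
    rcases hM with ⟨x, hx, hUx, rfl⟩ | ⟨x, hx, hUx, rfl⟩ | ⟨x, hx, hUx, -, rfl⟩ <;>
    · have := h.lt_top x hx; linarith
  have hMlow : - W ≤ M := by
    have := hMU u huS hUu; have := h.upper_nonneg u huS hUu; omega
  have hkey : ∀ x ∈ S, U x → v a < v x → M < T x + W := by
    intro x hx hUx hax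
    rcases hM with ⟨z, hz, hUz, rfl⟩ | ⟨z, hz, hUz, rfl⟩ | ⟨z, hz, hUz, hza, rfl⟩
    · rcases lt_trichotomy (p x) (p z) with h1 | h1 | h1
      · have := h.spread x hx z hz hUx hUz h1 fun l hl hUl _ => (hLv l hl hUl).trans hax
        omega
      · rw [hp h1]; omega
      · have := h.upper z hz x hx hUz hUx h1; omega
    · exact h.v_gt x hx z hz hUx hUz ((hLv z hz hUz).trans hax)
    · have h1 : p z < p x := by
        rcases lt_trichotomy (p x) (p z) with h1 | h1 | h1
        · have := hUv x hx z hz hUx hUz h1; omega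
        · rw [hp h1] at hax; omega
        · exact h1
      have := h.upper z hz x hx hUz hUx h1; omega
  let T' : Y → ℤ := fun x => if x = a then 2 * M + 1 else 2 * T x
  have hTa : T' a = 2 * M + 1 := by simp [T']
  have hTS : ∀ x ∈ S, T' x = 2 * T x := fun x hx => by simp [T', hne x hx]
  refine ⟨T', 2 * W, ⟨by omega, ?_, ?_, ?_, ?_, ?_, ?_, ?_, ?_, ?_, ?_, ?_, ?_⟩⟩
  · simp only [Finset.forall_mem_insert]
    refine ⟨⟨by simp, fun y hy h1 => absurd h1 hUa⟩,
      fun x hx => ⟨fun _ h1 => absurd h1 hUa, fun y hy => ?_⟩⟩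
    rw [hTS x hx, hTS y hy]
    intro h1 h2 h3; have := h.upper x hx y hy h1 h2 h3; omega
  · simp only [Finset.forall_mem_insert]
    refine ⟨⟨by simp, fun y hy _ _ hlt => ?_⟩, fun x hx => ⟨fun hUx _ _ => ?_, fun y hy => ?_⟩⟩
    · have := hpa y hy; omega
    · have := hML x hx hUx; rw [hTa, hTS x hx]; omega
    · rw [hTS x hx, hTS y hy]
      intro h1 h2 h3; have := h.lower x hx y hy h1 h2 h3; omega
  · simp only [Finset.forall_mem_insert]
    refine ⟨⟨by simp, fun y hy h1 => absurd h1 hUa⟩,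
      fun x hx => ⟨fun hUx _ hlt => ?_, fun y hy => ?_⟩⟩
    · have := hMU x hx hUx; rw [hTa, hTS x hx]; omega
    · rw [hTS x hx, hTS y hy]
      intro h1 h2 h3; have := h.p_lt x hx y hy h1 h2 h3; omega
  · simp only [Finset.forall_mem_insert]
    refine ⟨⟨by simp, fun y hy h1 => absurd h1 hUa⟩,
      fun x hx => ⟨fun hUx _ hlt => ?_, fun y hy => ?_⟩⟩
    · have := hpa x hx; omega
    · rw [hTS x hx, hTS y hy]
      intro h1 h2 h3; have := h.p_gt x hx y hy h1 h2 h3; omega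
  · simp only [Finset.forall_mem_insert]
    refine ⟨⟨by simp, fun y hy h1 => absurd h1 hUa⟩,
      fun x hx => ⟨fun hUx _ hlt => ?_, fun y hy => ?_⟩⟩
    · have := hMb x hx hUx hlt; rw [hTa, hTS x hx]; omega
    · rw [hTS x hx, hTS y hy]
      intro h1 h2 h3; have := h.v_lt x hx y hy h1 h2 h3; omega
  · simp only [Finset.forall_mem_insert]
    refine ⟨⟨by simp, fun y hy h1 => absurd h1 hUa⟩,
      fun x hx => ⟨fun hUx _ hlt => ?_, fun y hy => ?_⟩⟩
    · have := hkey x hx hUx hlt; rw [hTa, hTS x hx]; omega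
    · rw [hTS x hx, hTS y hy]
      intro h1 h2 h3; have := h.v_gt x hx y hy h1 h2 h3; omega
  · simp only [Finset.forall_mem_insert]
    refine ⟨⟨by simp, fun y hy h1 => absurd h1 hUa⟩,
      fun x hx => ⟨fun _ h1 => absurd h1 hUa, fun y hy => ?_⟩⟩
    rw [hTS x hx, hTS y hy]
    intro h1 h2 h3 h4; have := h.spread x hx y hy h1 h2 h3 h4.2; omega
  · simp only [Finset.forall_mem_insert]
    refine ⟨fun h1 => absurd h1 hUa, fun x hx hUx => ?_⟩
    rw [hTS x hx, Int.mul_ediv_mul_of_pos _ _ (by norm_num)]; exact h.upper_even x hx hUx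
  · simp only [Finset.forall_mem_insert]
    refine ⟨fun _ => ?_, fun x hx hUx => ?_⟩
    · rw [hTa, two_mul_add_one_ediv]; exact hpar
    · rw [hTS x hx, Int.mul_ediv_mul_of_pos _ _ (by norm_num)]; exact h.lower_odd x hx hUx
  · simp only [Finset.forall_mem_insert]
    refine ⟨fun h1 => absurd h1 hUa, fun x hx hUx => ?_⟩
    have := h.upper_nonneg x hx hUx; rw [hTS x hx]; omega
  · simp only [Finset.forall_mem_insert]
    refine ⟨fun h1 => by omega, fun x hx hUx => ?_⟩
    have := h.lower_ge x hx hUx; rw [hTS x hx]; omega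
  · simp only [Finset.forall_mem_insert]
    rw [Finset.card_insert_of_notMem ha]; push_cast
    refine ⟨by rw [hTa]; linarith, fun x hx => ?_⟩
    have := h.lt_top x hx; rw [hTS x hx]; linarith

end Insertion

/-- No three points in strictly decreasing position. -/
def NoDecreasingTriple {Y : Type*} (p v : Y → ℤ) : Prop :=
  ∀ x y z, p x < p y → p y < p z → v z < v y → v y < v x → False

-- Points are inserted in order of position, with `U` the left-to-right maxima. Every other point
-- has such a maximum to its upper left, so a descent among the others would complete a 321.
open Classical in
theorem exists_twoLineCoords {Y : Type*} [Fintype Y] {p v : Y → ℤ} (hp : Function.Injective p)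
    (hv : Function.Injective v) (h : NoDecreasingTriple p v) :
    ∃ (U : Y → Prop) (T : Y → ℤ) (W : ℤ), (∀ x y, (U x ↔ U y) → p x < p y → v x < v y) ∧
      TwoLineCoords p v U Finset.univ T W := by
  let U : Y → Prop := fun x => ∀ y, p y < p x → v y < v x
  have hex : ∀ a, ¬ U a → ∃ x, p x < p a ∧ U x ∧ v a < v x := by
    intro a ha
    obtain ⟨y, hy⟩ := not_forall.1 ha
    rw [Classical.not_imp, not_lt] at hy
    refine ⟨y, hy.1, fun z hz => ?_, lt_of_le_of_ne hy.2 fun e => ?_⟩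
    · by_contra hzy
      rcases (not_lt.1 hzy).lt_or_eq with h1 | h1
      · rcases hy.2.lt_or_eq with h2 | h2
        · exact h z y a hz hy.1 h2 h1
        · rw [hv h2] at hy; exact lt_irrefl _ hy.1
      · rw [hv h1] at hz; exact lt_irrefl _ hz
    · rw [hv e] at hy; exact lt_irrefl _ hy.1
  suffices H : ∀ S : Finset Y, (∀ x y, y ∈ S → p x < p y → x ∈ S) →
      ∃ T W, TwoLineCoords p v U S T W by
    obtain ⟨T, W, hTW⟩ := H Finset.univ (by simp)
    refine ⟨U, T, W, fun x y hU hxy => ?_, hTW⟩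
    by_cases hUy : U y
    · exact hUy x hxy
    · obtain ⟨z, hz1, -, hz2⟩ := hex x (mt hU.1 hUy)
      refine lt_of_le_of_ne (not_lt.1 fun h1 => h z x y hz1 hxy h1 hz2) fun e => ?_
      rw [hv e] at hxy; exact lt_irrefl _ hxy
  intro S
  refine Finset.induction_on_max_value p S ?_ ?_
  · exact fun _ => ⟨fun _ => 0, 1, by constructor <;> simp⟩
  · intro a s ha hmax ih hdown
    have hlt : ∀ x ∈ s, p x < p a := fun x hx =>
      lt_of_le_of_ne (hmax x hx) fun e => ha (hp e ▸ hx)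
    obtain ⟨T, W, hTW⟩ := ih fun x y hy hxy => by
      have := hdown x y (Finset.mem_insert_of_mem hy) hxy
      rcases Finset.mem_insert.1 this with rfl | h1
      · exact absurd (hlt y hy) (by omega)
      · exact h1
    by_cases hUa : U a
    · exact hTW.insert_upper hp ha hlt hUa fun x hx => hUa x (hlt x hx)
    · have hne : ∀ x ∈ s, v x ≠ v a := fun x hx e => ha (hv e ▸ hx)
      refine hTW.insert_lower hp ha hlt hUa (fun x _ y _ _ hUy hxy => hUy x hxy) ?_ ?_
      · intro x hx hUx
        obtain ⟨y, hy1, -, hy2⟩ := hex x hUx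
        exact lt_of_le_of_ne (not_lt.1 fun h1 => h y x a hy1 (hlt x hx) h1 hy2) (hne x hx)
      · obtain ⟨x, hx1, hx2, hx3⟩ := hex a hUa
        refine ⟨x, ?_, hx2, hx3⟩
        rcases Finset.mem_insert.1 (hdown x a (Finset.mem_insert_self a s) hx1) with rfl | h1
        · exact absurd hx1 (lt_irrefl _)
        · exact h1
-- Embedding into a descending staircase
/-- The order in the coordinate `e` (`0`: position, `1`: value) of the points `(k, j)` and
`(k', j')` (column, height) of a descending staircase. -/
def StairLt (e k j k' j' : ℕ) : Prop :=
  -- Columns `k` and `k + 1` interleave in coordinate `e` when `e + k` is odd, as `(k, 0) < (k + 1,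
  -- 0) < (k, 1) < ...`. Otherwise column `k + 1` lies wholly before column `k`.
  k' + 2 ≤ k ∨ (k = k' ∧ j < j') ∨ (k = k' + 1 ∧ ((e + k') % 2 = 1 → j < j')) ∨
    (k' = k + 1 ∧ (e + k) % 2 = 1 ∧ j ≤ j')

theorem ediv_lex {A B W : ℤ} (hW : 0 < W) (h : A < B) :
    A / W < B / W ∨ (A / W = B / W ∧ A % W < B % W) := by
  rcases (Int.ediv_le_ediv hW h.le).lt_or_eq with h1 | h1
  · exact Or.inl h1
  · refine Or.inr ⟨h1, ?_⟩
    have hA := Int.mul_ediv_add_emod A W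
    have hB := Int.mul_ediv_add_emod B W
    rw [h1] at hA; linarith

/-- The quotient of the two-line coordinate by `W` gives the column, counted backwards because the
staircase descends, and the remainder gives the height. The lines differ by a shift of `W`, so
comparing points is lexicographic in quotient and remainder. -/
theorem exists_staircase {Y : Type*} [Fintype Y] {p v : Y → ℤ} (hp : Function.Injective p)
    (hv : Function.Injective v) (h : NoDecreasingTriple p v) :
    ∃ (κ j : Y → ℕ) (D t : ℕ), (∀ x, κ x ≤ D ∧ j x ≤ t) ∧
      ∀ x y, (p x < p y → StairLt 0 (κ x) (j x) (κ y) (j y)) ∧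
        (v x < v y → StairLt 1 (κ x) (j x) (κ y) (j y)) := by
  obtain ⟨U, T, W, hmono, H⟩ := exists_twoLineCoords hp hv h
  have hW := H.pos
  set N := Fintype.card Y with hN
  have hbd : ∀ x, -1 ≤ T x / W ∧ T x / W ≤ N := by
    intro x
    constructor
    · rw [Int.le_ediv_iff_mul_le hW]
      by_cases hx : U x
      · have := H.upper_nonneg x (Finset.mem_univ _) hx; linarith
      · have := H.lower_ge x (Finset.mem_univ _) hx; linarith
    · have h1 := H.lt_top x (Finset.mem_univ _)
      rw [Finset.card_univ] at h1
      have := Int.ediv_lt_of_lt_mul hW h1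
      omega
  -- `2 * N + 3` is odd, which puts upper points in odd columns, and exceeds `T x / W`, so `toNat`
  -- does not truncate.
  refine ⟨fun x => (2 * N + 3 - T x / W).toNat, fun x => (T x % W).toNat, 2 * N + 4, W.toNat,
    fun x => ⟨?_, ?_⟩, ?_⟩
  · have := hbd x; dsimp only; omega
  · have := Int.emod_lt_of_pos (T x) hW; dsimp only; omega
  intro x y
  have bx := hbd x
  have bY := hbd y
  have rx := Int.emod_nonneg (T x) hW.ne'
  have ry := Int.emod_nonneg (T y) hW.ne'
  have lexadd : ∀ {A B : ℤ}, A < B + W → A / W < B / W + 1 ∨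
      (A / W = B / W + 1 ∧ A % W < B % W) := by
    intro A B hAB
    have := ediv_lex hW hAB
    rwa [add_ediv_self _ _ hW, Int.add_emod_right] at this
  have lexadd' : ∀ {A B : ℤ}, A + W < B → A / W + 1 < B / W ∨
      (A / W + 1 = B / W ∧ A % W < B % W) := by
    intro A B hAB
    have := ediv_lex hW hAB
    rwa [add_ediv_self _ _ hW, Int.add_emod_right] at this
  have mx := Finset.mem_univ x
  have my := Finset.mem_univ y
  have vp : (U x ↔ U y) → v x < v y → p x < p y := by
    intro hU hlt
    rcases lt_trichotomy (p x) (p y) with h1 | h1 | h1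
    · exact h1
    · rw [hp h1] at hlt; exact absurd hlt (lt_irrefl _)
    · exact absurd (hmono y x hU.symm h1) hlt.asymm
  unfold StairLt
  dsimp only
  by_cases hx : U x <;> by_cases hy : U y
  · have ex := H.upper_even x mx hx
    have ey := H.upper_even y my hy
    have main : p x < p y → _ := fun hlt => ediv_lex hW (H.upper x mx y my hx hy hlt)
    refine ⟨fun hlt => ?_, fun hlt => ?_⟩
    · have := main hlt; omega
    · have := main (vp (by tauto) hlt); omega
  · have ex := H.upper_even x mx hx
    have ey := H.lower_odd y my hy
    refine ⟨fun hlt => ?_, fun hlt => ?_⟩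
    · have := lexadd (H.p_lt x mx y my hx hy hlt); omega
    · have := lexadd' (H.v_lt x mx y my hx hy hlt); omega
  · have ex := H.lower_odd x mx hx
    have ey := H.upper_even y my hy
    refine ⟨fun hlt => ?_, fun hlt => ?_⟩
    · have := lexadd' (H.p_gt y my x mx hy hx hlt); omega
    · have := lexadd (H.v_gt y my x mx hy hx hlt); omega
  · have ex := H.lower_odd x mx hx
    have ey := H.lower_odd y my hy
    have main : p x < p y → _ := fun hlt => ediv_lex hW (H.lower x mx y my hx hy hlt)
    refine ⟨fun hlt => ?_, fun hlt => ?_⟩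
    · have := main hlt; omega
    · have := main (vp (by tauto) hlt); omega

/-! ### Parities of lines -/

open Classical in
/-- The indicator of a proposition, modulo 2. -/
noncomputable def ind (P : Prop) : ZMod 2 := if P then 1 else 0

theorem ind_of {P : Prop} (h : P) : ind P = 1 := if_pos h

theorem ind_of_not {P : Prop} (h : ¬ P) : ind P = 0 := if_neg h

theorem ind_not (P : Prop) : ind (¬ P) = 1 + ind P := by
  by_cases h : P
  · rw [ind_of h, ind_of_not (not_not.2 h)]; rfl
  · rw [ind_of_not h, ind_of h]; rfl

/-- The parity of the number of entries of `l` that are at most `z`. -/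
noncomputable def par (l : List ℤ) (z : ℤ) : ZMod 2 := (l.map fun a => ind (a ≤ z)).sum

@[simp] theorem par_nil (z : ℤ) : par [] z = 0 := rfl

@[simp] theorem par_cons (a : ℤ) (l : List ℤ) (z : ℤ) :
    par (a :: l) z = ind (a ≤ z) + par l z := by simp [par]

theorem par_append (l l' : List ℤ) (z : ℤ) : par (l ++ l') z = par l z + par l' z := by
  simp [par]

theorem par_eq_length {l : List ℤ} {z : ℤ} (h : ∀ a ∈ l, a ≤ z) : par l z = l.length := by
  induction l with
  | nil => simp
  | cons a l ih =>
    rw [par_cons, ind_of (h a (by simp)), ih fun b hb => h b (by simp [hb])]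
    push_cast [List.length_cons]; ring

/-- The first argument if `i` is even and the second one if `i` is odd. -/
def sel {α : Type*} (i : ℕ) (a b : α) : α := if i % 2 = 0 then a else b

theorem sel_add_two {α : Type*} (i : ℕ) (a b : α) : sel (i + 2) a b = sel i a b := by
  simp [sel]

/-! ### Two chains and the steps between them -/

/-- Two increasing chains `U` and `¬ U` cover the points. -/
structure TwoChains {X : Type*} (p v : X → ℤ) (U : X → Prop) : Prop where
  p_inj : Function.Injective p
  v_inj : Function.Injective v
  mono : ∀ x y, (U x ↔ U y) → p x < p y → v x < v y

/-- The points in the chain numbered `k`: `U` for even `k`. -/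
def InChain {X : Type*} (U : X → Prop) (k : ℕ) (x : X) : Prop := U x ↔ k % 2 = 0

section Basic
variable {X : Type*} {p v : X → ℤ} {U : X → Prop}

theorem inChain_congr {k k' : ℕ} (h : k % 2 = k' % 2) (x : X) :
    InChain U k x ↔ InChain U k' x := by simp [InChain, h]

theorem inChain_not {k k' : ℕ} (h : (k + k') % 2 = 1) (x : X) :
    InChain U k' x ↔ ¬ InChain U k x := by
  unfold InChain
  by_cases hx : U x <;> simp [hx] <;> omega

theorem InChain.iff {k : ℕ} {x y : X} (hx : InChain U k x) (hy : InChain U k y) : U x ↔ U y :=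
  hx.trans hy.symm

theorem TwoChains.coord_inj (h : TwoChains p v U) (i : ℕ) {x y : X}
    (e : sel i (p x) (v x) = sel i (p y) (v y)) : x = y := by
  unfold sel at e
  split_ifs at e
  · exact h.p_inj e
  · exact h.v_inj e

theorem TwoChains.coord_lt (h : TwoChains p v U) {x y : X} (hU : U x ↔ U y) (i : ℕ) :
    sel i (p x) (v x) < sel i (p y) (v y) ↔ p x < p y := by
  unfold sel
  split_ifs
  · rfl
  · refine ⟨fun hlt => ?_, h.mono x y hU⟩
    rcases lt_trichotomy (p x) (p y) with h1 | h1 | h1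
    · exact h1
    · rw [h.p_inj h1] at hlt; exact absurd hlt (lt_irrefl _)
    · exact absurd (h.mono y x hU.symm h1) hlt.asymm

theorem TwoChains.coord_le (h : TwoChains p v U) {x y : X} (hU : U x ↔ U y) (i : ℕ) :
    sel i (p x) (v x) ≤ sel i (p y) (v y) ↔ p x ≤ p y := by
  rw [← not_lt, ← not_lt, h.coord_lt hU.symm]

/-- `z` is the first point of `C` after `w`. -/
def IsNext (C : X → Prop) (f : X → ℤ) (w z : X) : Prop :=
  C z ∧ f w < f z ∧ ∀ y, C y → f w < f y → f z ≤ f y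

theorem exists_isNext [Finite X] {C : X → Prop} {f : X → ℤ} {w y : X} (hy : C y)
    (hwy : f w < f y) : ∃ z, IsNext C f w z := by
  obtain ⟨z, hz, hmin⟩ := Set.exists_min_image {z | C z ∧ f w < f z} f (Set.toFinite _)
    ⟨y, hy, hwy⟩
  exact ⟨z, hz.1, hz.2, fun y h1 h2 => hmin y ⟨h1, h2⟩⟩

open Classical in
/-- The first point of `C` after `w` (if there is any). -/
noncomputable def next (C : X → Prop) (f : X → ℤ) (w : X) : X :=
  if h : ∃ z, IsNext C f w z then h.choose else w

theorem isNext_next [Finite X] {C : X → Prop} {f : X → ℤ} {w y : X} (hy : C y)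
    (hwy : f w < f y) : IsNext C f w (next C f w) := by
  have h := exists_isNext hy hwy
  rw [next, dif_pos h]; exact h.choose_spec

/-- What lies beyond a line through `w` is a final segment of each chain: from `w` in its own chain,
from `z` in the other. So one step of a walk is exchanged for one line. -/
theorem TwoChains.line_eq (h : TwoChains p v U) {k k' i : ℕ} (hk : (k + k') % 2 = 1) {w z : X}
    (hw : InChain U k w)
    (hz : IsNext (InChain U k') (fun x => sel i (p x) (v x)) w z) (x : X) :
    ind (sel i (p w) (v w) ≤ sel i (p x) (v x)) =
      ind (InChain U k x ∧ p w ≤ p x) + ind (InChain U k' x ∧ p z ≤ p x) := by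
  obtain ⟨hz1, hz2, hz3⟩ := hz
  by_cases hx : InChain U k x
  · have hx' : ¬ InChain U k' x := fun h1 => (inChain_not hk x).1 h1 hx
    simp only [hx, hx', true_and, false_and, ind_of_not not_false, add_zero, h.coord_le (hw.iff hx)]
  · have hx' : InChain U k' x := (inChain_not hk x).2 hx
    simp only [hx, hx', true_and, false_and, ind_of_not not_false, zero_add]
    congr 1
    rw [← h.coord_le (hz1.iff hx') i, eq_iff_iff]
    refine ⟨fun hle => hz3 x hx' (lt_of_le_of_ne hle fun e => ?_), fun hle => hz2.le.trans hle⟩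
    rw [h.coord_inj i e] at hw; exact hx hw

end Basic

/-! ### Cuts and walks to the lower left of a corner -/

/-- The `n` lines `A`, `B` separate the points according to `δ`. -/
def Cut {X : Type*} (p v : X → ℤ) (x₀ y₀ : ℤ) (n : ℕ) (δ : X → ZMod 2) : Prop :=
  ∃ A B : List ℤ, A.length + B.length = n ∧ (∀ a ∈ A, a ≤ x₀) ∧ (∀ b ∈ B, b ≤ y₀) ∧
    ∀ x, par A (p x) + par B (v x) = δ x

theorem Cut.add_line {X : Type*} {p v : X → ℤ} {x₀ y₀ : ℤ} {n : ℕ} {δ : X → ZMod 2}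
    (h : Cut p v x₀ y₀ n δ) (i : ℕ) {w : X} (hw : sel i (p w) (v w) ≤ sel i x₀ y₀) :
    Cut p v x₀ y₀ (n + 1)
      (fun x => δ x + ind (sel i (p w) (v w) ≤ sel i (p x) (v x))) := by
  obtain ⟨A, B, hn, hA, hB, hδ⟩ := h
  unfold sel at *
  by_cases hi : i % 2 = 0
  · simp only [hi, if_true] at *
    refine ⟨p w :: A, B, by simp; omega, ?_, hB, fun x => ?_⟩
    · simp only [List.forall_mem_cons]; exact ⟨hw, hA⟩
    · dsimp only; rw [par_cons, ← hδ]; ring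
  · simp only [hi, if_false] at *
    refine ⟨A, v w :: B, by simp; omega, hA, ?_, fun x => ?_⟩
    · simp only [List.forall_mem_cons]; exact ⟨hw, hB⟩
    · dsimp only; rw [par_cons, ← hδ]; ring

/-- The corner `(x₀, y₀)` has points of `U` to its upper left, the first of them being `q`,
and points of the other chain to its lower right, the first of them being `b`. -/
structure IsCorner {X : Type*} (p v : X → ℤ) (U : X → Prop) (x₀ y₀ : ℤ) (q b : X) :
    Prop where
  q_upper : U q
  q_lt : p q < x₀
  q_ge : y₀ ≤ v q
  q_first : ∀ x, U x → y₀ ≤ v x → p q ≤ p x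
  b_lower : ¬ U b
  b_lt : v b < y₀
  b_ge : x₀ ≤ p b
  b_first : ∀ x, ¬ U x → x₀ ≤ p x → p b ≤ p x

section Walk
variable {X : Type*} (p v : X → ℤ) (U : X → Prop) (q b : X)

/-- The zigzag from `q`. -/
noncomputable def zigA : ℕ → X
  | 0 => q
  | k + 1 => next (InChain U (k + 1)) (fun x => sel k (p x) (v x)) (zigA k)

/-- The zigzag from `b`; its term `k` is in the chain `k + 1`. -/
noncomputable def zigB : ℕ → X
  | 0 => b
  | k + 1 => next (InChain U (k + 2)) (fun x => sel (k + 1) (p x) (v x)) (zigB k)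

/-- The furthest point of the column `k` that `n` rounds of zigzags from `q` arrive at. -/
noncomputable def reach : ℕ → ℕ → X
  | _, 0 => q
  | 0, k + 1 => zigA p v U q (k + 1)
  | n + 1, k + 1 =>
    if p (next (InChain U (k + 1)) (fun x => sel k (p x) (v x)) (reach n k)) ≤
        p (next (InChain U (k + 1)) (fun x => sel (k + 1) (p x) (v x)) (reach n (k + 2)))
    then next (InChain U (k + 1)) (fun x => sel (k + 1) (p x) (v x)) (reach n (k + 2))
    else next (InChain U (k + 1)) (fun x => sel k (p x) (v x)) (reach n k)

variable {p v U q b} {x₀ y₀ : ℤ}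

/-- The terms `zigA k` and `zigB k` are in opposite orders in the two coordinates. Hence each is a
candidate for the successor of the other, and no `next` takes its default value. -/
theorem zig_spec [Finite X] (h : TwoChains p v U) (hc : IsCorner p v U x₀ y₀ q b) (k : ℕ) :
    InChain U k (zigA p v U q k) ∧ InChain U (k + 1) (zigB p v U b k) ∧
    sel k (p (zigA p v U q k)) (v (zigA p v U q k)) <
      sel k (p (zigB p v U b k)) (v (zigB p v U b k)) ∧
    sel (k + 1) (p (zigB p v U b k)) (v (zigB p v U b k)) <
      sel (k + 1) (p (zigA p v U q k)) (v (zigA p v U q k)) := by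
  induction k with
  | zero =>
    refine ⟨by simp [InChain, zigA, hc.q_upper], by simp [InChain, zigB, hc.b_lower], ?_, ?_⟩
    · simpa [sel, zigA, zigB] using hc.q_lt.trans_le hc.b_ge
    · simpa [sel, zigA, zigB] using hc.b_lt.trans_le hc.q_ge
  | succ k ih =>
    obtain ⟨hA, hB, h1, h2⟩ := ih
    have nA := isNext_next (f := fun x => sel k (p x) (v x)) hB h1
    have hA2 : InChain U (k + 2) (zigA p v U q k) := (inChain_congr (by omega) _).1 hA
    have nB := isNext_next (f := fun x => sel (k + 1) (p x) (v x)) hA2 h2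
    have eA : zigA p v U q (k + 1) =
      next (InChain U (k + 1)) (fun x => sel k (p x) (v x)) (zigA p v U q k) := rfl
    have eB : zigB p v U b (k + 1) =
      next (InChain U (k + 2)) (fun x => sel (k + 1) (p x) (v x)) (zigB p v U b k) := rfl
    rw [← eA] at nA; rw [← eB] at nB
    refine ⟨nA.1, nB.1, ?_, ?_⟩
    · refine lt_of_le_of_lt ?_ nB.2.1
      exact (h.coord_le (nA.1.iff hB) _).2 ((h.coord_le (nA.1.iff hB) _).1 (nA.2.2 _ hB h1))
    · simp only [sel_add_two]
      refine lt_of_le_of_lt ?_ nA.2.1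
      exact (h.coord_le (nB.1.iff hA2) _).2 ((h.coord_le (nB.1.iff hA2) _).1 (nB.2.2 _ hA2 h2))

theorem zigA_next [Finite X] (h : TwoChains p v U) (hc : IsCorner p v U x₀ y₀ q b) (k : ℕ) :
    IsNext (InChain U (k + 1)) (fun x => sel k (p x) (v x)) (zigA p v U q k)
      (zigA p v U q (k + 1)) :=
  isNext_next (zig_spec h hc k).2.1 (zig_spec h hc k).2.2.1

theorem zigB_next [Finite X] (h : TwoChains p v U) (hc : IsCorner p v U x₀ y₀ q b) (k : ℕ) :
    IsNext (InChain U (k + 2)) (fun x => sel (k + 1) (p x) (v x)) (zigB p v U b k)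
      (zigB p v U b (k + 1)) :=
  isNext_next (f := fun x => sel (k + 1) (p x) (v x))
    ((inChain_congr (by omega) _).1 (zig_spec h hc k).1) (zig_spec h hc k).2.2.2

theorem zigA_le_zigB [Finite X] (h : TwoChains p v U) (hc : IsCorner p v U x₀ y₀ q b) (k : ℕ) :
    p (zigA p v U q (k + 1)) ≤ p (zigB p v U b k) :=
  (h.coord_le ((zig_spec h hc (k + 1)).1.iff (zig_spec h hc k).2.1) k).1
    ((zigA_next h hc k).2.2 _ (zig_spec h hc k).2.1 (zig_spec h hc k).2.2.1)

theorem zigB_le_zigA [Finite X] (h : TwoChains p v U) (hc : IsCorner p v U x₀ y₀ q b) (k : ℕ) :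
    p (zigB p v U b (k + 1)) ≤ p (zigA p v U q k) := by
  have hA2 : InChain U (k + 2) (zigA p v U q k) :=
    (inChain_congr (by omega) _).1 (zig_spec h hc k).1
  exact (h.coord_le ((zig_spec h hc (k + 1)).2.1.iff hA2) (k + 1)).1
    ((zigB_next h hc k).2.2 _ hA2 (zig_spec h hc k).2.2.2)

/-- On one chain the zigzags alternate downwards: `zigB (k + 3) ≤ zigA (k + 2) ≤ zigB (k + 1) ≤ zigA
k`. -/
theorem zigB_le_zigA_add [Finite X] (h : TwoChains p v U) (hc : IsCorner p v U x₀ y₀ q b)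
    (k i : ℕ) : p (zigB p v U b (k + 1 + 2 * i)) ≤ p (zigA p v U q k) := by
  induction i with
  | zero => exact zigB_le_zigA h hc k
  | succ i ih =>
    rw [show k + 1 + 2 * i = k + 2 * i + 1 by omega] at ih
    rw [show k + 1 + 2 * (i + 1) = k + 2 * i + 2 + 1 by omega]
    exact (zigB_le_zigA h hc (k + 2 * i + 2)).trans ((zigA_le_zigB h hc (k + 2 * i + 1)).trans ih)

theorem zigB_le_start [Finite X] (h : TwoChains p v U) (hc : IsCorner p v U x₀ y₀ q b)
    (k : ℕ) : (k % 2 = 0 → p (zigB p v U b k) ≤ p b) ∧ (k % 2 = 1 → p (zigB p v U b k) ≤ p q) := by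
  constructor
  · intro hk
    rcases Nat.eq_zero_or_pos k with rfl | h0
    · exact le_rfl
    · have := zigB_le_zigA_add h hc 1 ((k - 2) / 2)
      rw [show 1 + 1 + 2 * ((k - 2) / 2) = k by omega] at this
      exact this.trans (zigA_le_zigB h hc 0)
  · intro hk
    have := zigB_le_zigA_add h hc 0 ((k - 1) / 2)
    rwa [show 0 + 1 + 2 * ((k - 1) / 2) = k by omega] at this

theorem coord_zigB_le [Finite X] (h : TwoChains p v U) (hc : IsCorner p v U x₀ y₀ q b)
    (k : ℕ) : sel (k + 1) (p (zigB p v U b k)) (v (zigB p v U b k)) ≤ sel (k + 1) x₀ y₀ := by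
  have hs := (zig_spec h hc k).2.1
  unfold sel
  split_ifs with hk
  · exact ((zigB_le_start h hc k).2 (by omega)).trans hc.q_lt.le
  · have hb : InChain U (k + 1) b := by simp [InChain, hc.b_lower, hk]
    have h1 := (zigB_le_start h hc k).1 (by omega)
    have := (h.coord_le (hs.iff hb) 1).2 h1
    simp only [sel] at this
    exact le_trans (by simpa using this) hc.b_lt.le

/-- Such a point precedes `b` or `q` on its own chain, and as these are the first points beyond the
corner, it is below the corner in both coordinates. -/
theorem coord_le_of_lt_zigB [Finite X] (h : TwoChains p v U) (hc : IsCorner p v U x₀ y₀ q b)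
    (k i : ℕ) {w : X} (hw : InChain U (k + 1) w) (hlt : p w < p (zigB p v U b k)) :
    sel i (p w) (v w) ≤ sel i x₀ y₀ := by
  unfold sel
  by_cases hk : k % 2 = 0
  · have hwU : ¬ U w := by unfold InChain at hw; rw [hw]; omega
    have h1 := hlt.trans_le ((zigB_le_start h hc k).1 hk)
    split_ifs
    · by_contra hcon
      exact absurd (hc.b_first w hwU (by omega)) (by omega)
    · have := h.mono w b (by simp [hwU, hc.b_lower]) h1
      have := hc.b_lt; omega
  · have hwU : U w := by unfold InChain at hw; rw [hw]; omega
    have h1 := hlt.trans_le ((zigB_le_start h hc k).2 (by omega))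
    split_ifs
    · have := hc.q_lt; omega
    · by_contra hcon
      exact absurd (hc.q_first w hwU (by omega)) (by omega)

/-- The points that differ in the chain `k` after a walk from `q` to `w`. -/
noncomputable def walkDiff (p v : X → ℤ) (U : X → Prop) (y₀ : ℤ) (k : ℕ) (w : X) (x : X) :
    ZMod 2 :=
  ind (U x ∧ y₀ ≤ v x) + ind (InChain U k x ∧ p w ≤ p x)

/-- Modulo 2, the line through `w` cancels the final segment starting at `w` and leaves the one
starting at `z`. -/
theorem Cut.walk (h : TwoChains p v U) {n k k' i : ℕ} {w z : X}
    (hcut : Cut p v x₀ y₀ n (walkDiff p v U y₀ k w)) (hk : (k + k') % 2 = 1)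
    (hw : InChain U k w)
    (hz : IsNext (InChain U k') (fun x => sel i (p x) (v x)) w z)
    (hcap : sel i (p w) (v w) ≤ sel i x₀ y₀) :
    Cut p v x₀ y₀ (n + 1) (walkDiff p v U y₀ k' z) := by
  convert hcut.add_line i hcap using 2 with x
  rw [h.line_eq hk hw hz, walkDiff, walkDiff]
  generalize ind (InChain U k x ∧ p w ≤ p x) = s
  linear_combination -(CharTwo.add_self_eq_zero s)

theorem Cut.walk_back (h : TwoChains p v U) {n k k' i : ℕ} {w z : X}
    (hcut : Cut p v x₀ y₀ n (walkDiff p v U y₀ k' z)) (hk : (k + k') % 2 = 1)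
    (hw : InChain U k w)
    (hz : IsNext (InChain U k') (fun x => sel i (p x) (v x)) w z)
    (hcap : sel i (p w) (v w) ≤ sel i x₀ y₀) :
    Cut p v x₀ y₀ (n + 1) (walkDiff p v U y₀ k w) := by
  convert hcut.add_line i hcap using 2 with x
  rw [h.line_eq hk hw hz, walkDiff, walkDiff]
  generalize ind (InChain U k' x ∧ p z ≤ p x) = s
  linear_combination -(CharTwo.add_self_eq_zero s)

theorem cut_zero (h : TwoChains p v U) (hc : IsCorner p v U x₀ y₀ q b) :
    Cut p v x₀ y₀ 0 (walkDiff p v U y₀ 0 q) := by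
  refine ⟨[], [], rfl, by simp, by simp, fun x => ?_⟩
  have : (InChain U 0 x ∧ p q ≤ p x) ↔ (U x ∧ y₀ ≤ v x) := by
    simp only [InChain, Nat.zero_mod, iff_true]
    refine and_congr_right fun hx => ⟨fun hle => ?_, hc.q_first x hx⟩
    have := (h.coord_le (x := q) (y := x) (by simp [hx, hc.q_upper]) 1).2 hle
    exact hc.q_ge.trans (by simpa [sel] using this)
  unfold walkDiff
  simp only [this, par_nil]
  exact (CharTwo.add_self_eq_zero _).symm

/-- The zigzag from `b` is traced backwards, one line for each of its `k` steps. -/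
theorem cut_of_zigB [Finite X] (h : TwoChains p v U) (hc : IsCorner p v U x₀ y₀ q b) :
    ∀ (k n : ℕ), Cut p v x₀ y₀ n (walkDiff p v U y₀ (k + 1) (zigB p v U b k)) →
      Cut p v x₀ y₀ (n + k) (fun x => ind (U x ∧ y₀ ≤ v x) +
        ind (¬ U x ∧ x₀ ≤ p x)) := by
  intro k
  induction k with
  | zero =>
    intro n hcut
    rw [Nat.add_zero]
    convert hcut using 2 with x
    unfold walkDiff
    congr 2
    simp only [InChain, zigB, eq_iff_iff]
    norm_num
    intro hx
    exact ⟨hc.b_first x hx, fun h1 => hc.b_ge.trans h1⟩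
  | succ k ih =>
    intro n hcut
    have := ih (n + 1) (hcut.walk_back h (k := k + 1) (by omega) (zig_spec h hc k).2.1
      (zigB_next h hc k) (coord_zigB_le h hc k))
    rwa [show n + 1 + k = n + (k + 1) by omega] at this

/-- The state of the walks after `n` rounds in the column `k`. -/
structure ReachSpec (p v : X → ℤ) (U : X → Prop) (x₀ y₀ : ℤ) (q b : X) (n k : ℕ) : Prop where
  inChain : InChain U k (reach p v U q n k)
  ge : p (zigA p v U q k) ≤ p (reach p v U q n k)
  coord_lt : sel k (p (reach p v U q n k)) (v (reach p v U q n k)) <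
    sel k (p (zigB p v U b k)) (v (zigB p v U b k))
  lt : ∀ j, k = j + 1 → p (reach p v U q n k) < p (zigB p v U b j)
  cap : sel k (p (reach p v U q n k)) (v (reach p v U q n k)) ≤ sel k x₀ y₀
  cut : ∃ m ≤ k + 2 * n, m % 2 = k % 2 ∧
    Cut p v x₀ y₀ m (walkDiff p v U y₀ k (reach p v U q n k))

theorem reachSpec_zero (h : TwoChains p v U) (hc : IsCorner p v U x₀ y₀ q b) (n : ℕ) :
    ReachSpec p v U x₀ y₀ q b n 0 := by
  have e : reach p v U q n 0 = q := by cases n <;> rfl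
  constructor
  · simp [e, InChain, hc.q_upper]
  · simp [e, zigA]
  · simpa [e, zigB, sel] using hc.q_lt.trans_le hc.b_ge
  · simp
  · simpa [e, sel] using hc.q_lt.le
  · exact ⟨0, by omega, rfl, by rw [e]; exact cut_zero h hc⟩

theorem reachSpec_of_lt [Finite X] (h : TwoChains p v U) (hc : IsCorner p v U x₀ y₀ q b)
    {n k : ℕ} (h1 : InChain U (k + 1) (reach p v U q n (k + 1)))
    (h2 : p (zigA p v U q (k + 1)) ≤ p (reach p v U q n (k + 1)))
    (h3 : p (reach p v U q n (k + 1)) < p (zigB p v U b k))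
    (h4 : ∃ m ≤ k + 1 + 2 * n, m % 2 = (k + 1) % 2 ∧
      Cut p v x₀ y₀ m (walkDiff p v U y₀ (k + 1) (reach p v U q n (k + 1)))) :
    ReachSpec p v U x₀ y₀ q b n (k + 1) where
  inChain := h1
  ge := h2
  coord_lt := ((h.coord_lt (h1.iff (zig_spec h hc k).2.1) _).2 h3).trans (zigB_next h hc k).2.1
  lt j hj := by obtain rfl : k = j := by omega
                exact h3
  cap := coord_le_of_lt_zigB h hc k _ h1 h3
  cut := h4

/-- Closing a walk that arrives at the zigzag from `b`. -/
theorem cut_of_hit [Finite X] (h : TwoChains p v U) (hc : IsCorner p v U x₀ y₀ q b)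
    {N n k : ℕ} (hk : k + 1 + 2 * n ≤ N) {w : X} (e : w = zigB p v U b k)
    (h4 : ∃ m ≤ k + 1 + 2 * n, m % 2 = (k + 1) % 2 ∧
      Cut p v x₀ y₀ m (walkDiff p v U y₀ (k + 1) w)) :
    ∃ m ≤ 2 * N, m % 2 = 1 ∧ Cut p v x₀ y₀ m
      (fun x => ind (U x ∧ y₀ ≤ v x) + ind (¬ U x ∧ x₀ ≤ p x)) := by
  obtain ⟨m, hm1, hm2, hm3⟩ := h4
  rw [e] at hm3
  exact ⟨m + k, by omega, by omega, cut_of_zigB h hc k m hm3⟩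

/-- Both continuations, forwards from column `k` and backwards from column `k + 2`, stop at or
before `zigB k`, which is a candidate for each. The further one is kept, so it lies beyond both
sources. -/
theorem reach_step [Finite X] (h : TwoChains p v U) (hc : IsCorner p v U x₀ y₀ q b)
    {n k : ℕ} (s1 : ReachSpec p v U x₀ y₀ q b n k) (s2 : ReachSpec p v U x₀ y₀ q b n (k + 2)) :
    (InChain U (k + 1) (reach p v U q (n + 1) (k + 1)) ∧
    p (zigA p v U q (k + 1)) ≤ p (reach p v U q (n + 1) (k + 1)) ∧
    p (reach p v U q (n + 1) (k + 1)) ≤ p (zigB p v U b k) ∧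
    ∃ m ≤ k + 1 + 2 * (n + 1), m % 2 = (k + 1) % 2 ∧
      Cut p v x₀ y₀ m (walkDiff p v U y₀ (k + 1) (reach p v U q (n + 1) (k + 1)))) ∧
    sel k (p (reach p v U q n k)) (v (reach p v U q n k)) <
      sel k (p (reach p v U q (n + 1) (k + 1))) (v (reach p v U q (n + 1) (k + 1))) ∧
    sel (k + 1) (p (reach p v U q n (k + 2))) (v (reach p v U q n (k + 2))) <
      sel (k + 1) (p (reach p v U q (n + 1) (k + 1))) (v (reach p v U q (n + 1) (k + 1))) := by
  have hb := (zig_spec h hc k).2.1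
  have n1 := isNext_next (f := fun x => sel k (p x) (v x)) hb s1.coord_lt
  have hlt : sel (k + 1) (p (reach p v U q n (k + 2))) (v (reach p v U q n (k + 2))) <
      sel (k + 1) (p (zigB p v U b k)) (v (zigB p v U b k)) := by
    have n3 := zigB_next h hc k
    by_contra hcon
    rcases (not_lt.1 hcon).lt_or_eq with h1 | h1
    · have := (h.coord_le (n3.1.iff s2.inChain) (k + 1)).1 (n3.2.2 _ s2.inChain h1)
      exact absurd (s2.lt (k + 1) rfl) (not_lt.2 this)
    · have := s2.inChain
      rw [← h.coord_inj _ h1] at this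
      exact (inChain_not (k := k + 1) (k' := k + 2) (by omega) _).1 this hb
  have n2 := isNext_next (f := fun x => sel (k + 1) (p x) (v x)) hb hlt
  have b1 := (h.coord_le (n1.1.iff hb) k).1 (n1.2.2 _ hb s1.coord_lt)
  have b2 := (h.coord_le (n2.1.iff hb) (k + 1)).1 (n2.2.2 _ hb hlt)
  have hA := zigA_next h hc k
  have a1 : p (zigA p v U q (k + 1)) ≤
      p (next (InChain U (k + 1)) (fun x => sel k (p x) (v x)) (reach p v U q n k)) := by
    refine (h.coord_le (hA.1.iff n1.1) k).1 (hA.2.2 _ n1.1 (lt_of_le_of_lt ?_ n1.2.1))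
    exact (h.coord_le ((zig_spec h hc k).1.iff s1.inChain) k).2 s1.ge
  obtain ⟨m1, hm1, hm1', hcut1⟩ := s1.cut
  obtain ⟨m2, hm2, hm2', hcut2⟩ := s2.cut
  have c1 := hcut1.walk h (i := k) (by omega) s1.inChain n1 s1.cap
  have c2 := hcut2.walk h (i := k + 1) (k' := k + 1) (by omega) s2.inChain n2
    (coord_le_of_lt_zigB h hc (k + 1) _ s2.inChain (s2.lt (k + 1) rfl))
  rw [reach]
  split_ifs with hle
  · refine ⟨⟨n2.1, a1.trans hle, b2, m2 + 1, by omega, by omega, c2⟩, ?_, n2.2.1⟩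
    exact n1.2.1.trans_le ((h.coord_le (n1.1.iff n2.1) k).2 hle)
  · refine ⟨⟨n1.1, a1, b1, m1 + 1, by omega, by omega, c1⟩, n1.2.1, ?_⟩
    exact n2.2.1.trans_le ((h.coord_le (n2.1.iff n1.1) (k + 1)).2 (not_le.1 hle).le)

/-- While no walk hits the zigzag from `b`, the weak inequalities against it are strict and the
walks continue. A hit in column `k + 1` closes a cut: the walk has used `k + 1` lines modulo 2 and
the way back uses `k`, an odd total. -/
theorem cut_or_reachSpec [Finite X] (h : TwoChains p v U) (hc : IsCorner p v U x₀ y₀ q b)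
    (N : ℕ) :
    (∃ m ≤ 2 * N, m % 2 = 1 ∧ Cut p v x₀ y₀ m
      (fun x => ind (U x ∧ y₀ ≤ v x) + ind (¬ U x ∧ x₀ ≤ p x))) ∨
    ∀ n k, k + 2 * n ≤ N → ReachSpec p v U x₀ y₀ q b n k := by
  refine or_iff_not_imp_left.2 fun hno => ?_
  have hA : ∀ k, k ≤ N → Cut p v x₀ y₀ k (walkDiff p v U y₀ k (zigA p v U q k)) ∧
      ∀ j, k = j + 1 → zigA p v U q (j + 1) ≠ zigB p v U b j := by
    intro k
    induction k using Nat.strong_induction_on with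
    | _ k ih =>
      intro hk
      rcases k with _ | k
      · exact ⟨cut_zero h hc, by simp⟩
      have hcap : sel k (p (zigA p v U q k)) (v (zigA p v U q k)) ≤ sel k x₀ y₀ := by
        rcases k with _ | k
        · simpa [zigA, sel] using hc.q_lt.le
        · refine coord_le_of_lt_zigB h hc k _ (zig_spec h hc (k + 1)).1 ?_
          exact lt_of_le_of_ne (zigA_le_zigB h hc k) fun e =>
            (ih (k + 1) (by omega) (by omega)).2 k rfl (h.p_inj e)
      have hcut' := (ih k (by omega) (by omega)).1.walk h (i := k) (k' := k + 1) (by omega)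
        (zig_spec h hc k).1 (zigA_next h hc k) hcap
      refine ⟨hcut', fun j hj e => hno ?_⟩
      obtain rfl : k = j := by omega
      exact cut_of_hit h hc (n := 0) (by omega) e ⟨k + 1, by omega, rfl, hcut'⟩
  intro n
  induction n with
  | zero =>
    rintro (_ | k) hk
    · exact reachSpec_zero h hc 0
    · refine reachSpec_of_lt h hc (zig_spec h hc (k + 1)).1 le_rfl ?_
        ⟨k + 1, by omega, rfl, (hA (k + 1) (by omega)).1⟩
      exact lt_of_le_of_ne (zigA_le_zigB h hc k) fun e =>
        (hA (k + 1) (by omega)).2 k rfl (h.p_inj e)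
  | succ n ih =>
    rintro (_ | k) hk
    · exact reachSpec_zero h hc (n + 1)
    · obtain ⟨⟨h1, h2, h3, h4⟩, -⟩ := reach_step h hc (ih k (by omega)) (ih (k + 2) (by omega))
      exact reachSpec_of_lt h hc h1 h2 (lt_of_le_of_ne h3 fun e =>
        hno (cut_of_hit h hc (n := n + 1) (by omega) (h.p_inj e) h4)) h4

end Walk

/-! ### The walks form a staircase -/

/-- `f` maps the points of `Y` to points in the same relative order. -/
def IsPatternEmb {Y X : Type*} (pY vY : Y → ℤ) (p v : X → ℤ) (f : Y → X) : Prop :=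
  ∀ a b, (pY a < pY b → p (f a) < p (f b)) ∧ (vY a < vY b → v (f a) < v (f b))

theorem sel_congr {α : Type*} {i j : ℕ} (h : i % 2 = j % 2) (a b : α) : sel i a b = sel j a b := by
  simp [sel, h]

section Staircase
variable {X : Type*} {p v : X → ℤ} {U : X → Prop} {q b : X} {x₀ y₀ : ℤ} {N : ℕ}

/-- The point of height `j` in the column `k` of the staircase formed by the walks. -/
noncomputable def stair (p v : X → ℤ) (U : X → Prop) (q : X) (k j : ℕ) : X :=
  -- With this choice of round, `(k + 1, j)` comes one round after `(k, j)`, and `(k, j + 1)` one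
  -- round after `(k + 1, j)`.
  reach p v U q (2 * j + k + 1) (k + 1)

theorem stair_lt_right [Finite X] (h : TwoChains p v U) (hc : IsCorner p v U x₀ y₀ q b)
    (hR : ∀ n k, k + 2 * n ≤ N → ReachSpec p v U x₀ y₀ q b n k) {k j : ℕ}
    (hb : 3 * k + 4 * j + 5 ≤ N) :
    sel (k + 1) (p (stair p v U q k j)) (v (stair p v U q k j)) <
      sel (k + 1) (p (stair p v U q (k + 1) j)) (v (stair p v U q (k + 1) j)) :=
  (reach_step h hc (hR (2 * j + k + 1) (k + 1) (by omega))
    (hR (2 * j + k + 1) (k + 1 + 2) (by omega))).2.1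

theorem stair_lt_left [Finite X] (h : TwoChains p v U) (hc : IsCorner p v U x₀ y₀ q b)
    (hR : ∀ n k, k + 2 * n ≤ N → ReachSpec p v U x₀ y₀ q b n k) {k j : ℕ}
    (hb : 3 * k + 4 * j + 6 ≤ N) :
    sel (k + 1) (p (stair p v U q (k + 1) j)) (v (stair p v U q (k + 1) j)) <
      sel (k + 1) (p (stair p v U q k (j + 1))) (v (stair p v U q k (j + 1))) := by
  have := (reach_step h hc (hR (2 * j + k + 2) k (by omega))
    (hR (2 * j + k + 2) (k + 2) (by omega))).2.2
  rw [show 2 * j + k + 2 + 1 = 2 * (j + 1) + k + 1 by omega] at this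
  exact this

theorem stair_mono [Finite X] (h : TwoChains p v U) (hc : IsCorner p v U x₀ y₀ q b)
    (hR : ∀ n k, k + 2 * n ≤ N → ReachSpec p v U x₀ y₀ q b n k) {k j j' : ℕ}
    (hj : j < j') (hb : 3 * k + 4 * j' + 6 ≤ N) :
    p (stair p v U q k j) < p (stair p v U q k j') := by
  induction j', hj using Nat.le_induction with
  | base =>
    have h1 := (stair_lt_right h hc hR (k := k) (j := j) (by omega)).trans
      (stair_lt_left h hc hR (k := k) (j := j) (by omega))
    exact (h.coord_lt ((hR _ _ (by omega)).inChain.iff (hR _ _ (by omega)).inChain) _).1 h1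
  | succ m hm ih =>
    have h1 := (stair_lt_right h hc hR (k := k) (j := m) (by omega)).trans
      (stair_lt_left h hc hR (k := k) (j := m) (by omega))
    exact (ih (by omega)).trans
      ((h.coord_lt ((hR _ _ (by omega)).inChain.iff (hR _ _ (by omega)).inChain) _).1 h1)

/-- Interleaving of neighbouring columns comes from the steps of the walks. Everything else is
separated by the zigzags: column `k` lies before `zigB k`, and column `k'` does not precede `zigA
(k' + 1)`. -/
theorem stair_lt [Finite X] (h : TwoChains p v U) (hc : IsCorner p v U x₀ y₀ q b)
    (hR : ∀ n k, k + 2 * n ≤ N → ReachSpec p v U x₀ y₀ q b n k) {e k j k' j' : ℕ}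
    (hb : 3 * k + 4 * j + 6 ≤ N) (hb' : 3 * k' + 4 * j' + 6 ≤ N) (hlt : StairLt e k j k' j') :
    sel e (p (stair p v U q k j)) (v (stair p v U q k j)) <
      sel e (p (stair p v U q k' j')) (v (stair p v U q k' j')) := by
  have s := hR (2 * j + k + 1) (k + 1) (by omega)
  have s' := hR (2 * j' + k' + 1) (k' + 1) (by omega)
  change ReachSpec p v U x₀ y₀ q b _ _ at s s'
  have l : p (stair p v U q k j) < p (zigB p v U b k) := s.lt k rfl
  have g : p (zigA p v U q (k' + 1)) ≤ p (stair p v U q k' j') := s'.ge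
  have c : InChain U (k + 1) (stair p v U q k j) := s.inChain
  have c' : InChain U (k' + 1) (stair p v U q k' j') := s'.inChain
  have cross : (k + k') % 2 = 1 → p (stair p v U q k j) < p (zigB p v U b (k' + 1)) →
      sel k' (p (stair p v U q k j)) (v (stair p v U q k j)) <
        sel k' (p (stair p v U q k' j')) (v (stair p v U q k' j')) := by
    intro hpar hl
    have hA := zigA_next h hc k'
    have hk : InChain U k' (stair p v U q k j) := (inChain_congr (by omega) _).1 c
    have h1 := (h.coord_lt (hk.iff (zig_spec h hc k').1) k').2
      (hl.trans_le (zigB_le_zigA h hc k'))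
    exact h1.trans (hA.2.1.trans_le ((h.coord_le (hA.1.iff c') k').2 g))
  rcases hlt with h1 | ⟨rfl, h1⟩ | ⟨rfl, h1⟩ | ⟨rfl, h1, h2⟩
  · rcases Nat.mod_two_eq_zero_or_one (k + k') with hpar | hpar
    · refine (h.coord_lt (((inChain_congr (by omega) _).1 c).iff c') e).2 ?_
      have := zigB_le_zigA_add h hc (k' + 1) ((k - k' - 2) / 2)
      rw [show k' + 1 + 1 + 2 * ((k - k' - 2) / 2) = k by omega] at this
      exact l.trans_le (this.trans g)
    · have h3 := zigB_le_zigA_add h hc (k' + 2) ((k - k' - 3) / 2)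
      rw [show k' + 2 + 1 + 2 * ((k - k' - 3) / 2) = k by omega] at h3
      have h4 := l.trans_le h3
      by_cases he : e % 2 = k' % 2
      · rw [sel_congr he, sel_congr he]
        exact cross hpar (h4.trans_le (zigA_le_zigB h hc (k' + 1)))
      · have he : e % 2 = (k' + 1) % 2 := by omega
        rw [sel_congr he, sel_congr he]
        have hA := zigA_next h hc (k' + 1)
        have hk : InChain U (k' + 1 + 1) (stair p v U q k j) := (inChain_congr (by omega) _).1 c
        have h5 : sel (k' + 1) (p (stair p v U q k j)) (v (stair p v U q k j)) ≤
            sel (k' + 1) (p (zigA p v U q (k' + 1))) (v (zigA p v U q (k' + 1))) := by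
          by_contra hcon
          have := (h.coord_le (hA.1.iff hk) (k' + 1)).1 (hA.2.2 _ hk (not_le.1 hcon))
          exact absurd h4 (not_lt.2 this)
        have h6 := (h.coord_le ((zig_spec h hc (k' + 1)).1.iff c') (k' + 1)).2 g
        refine lt_of_le_of_ne (h5.trans h6) fun e1 => ?_
        rw [h.coord_inj _ e1] at hk
        exact (inChain_not (k := k' + 1) (k' := k' + 1 + 1) (by omega) _).1 hk c'
  · exact (h.coord_lt (c.iff c') e).2 (stair_mono h hc hR h1 (by omega))
  · by_cases he : (e + k') % 2 = 1
    · have he' : e % 2 = (k' + 1) % 2 := by omega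
      rw [sel_congr he', sel_congr he']
      refine (stair_lt_left h hc hR (k := k') (j := j) (by omega)).trans_le ?_
      rcases (Nat.succ_le_of_lt (h1 he)).lt_or_eq with h3 | h3
      · exact (h.coord_le ((hR (2 * (j + 1) + k' + 1) (k' + 1) (by omega)).inChain.iff c') _).2
          (stair_mono h hc hR h3 (by omega)).le
      · rw [← h3]
    · have he' : e % 2 = k' % 2 := by omega
      rw [sel_congr he', sel_congr he']
      exact cross (by omega) l
  · have he' : e % 2 = (k + 1) % 2 := by omega
    rw [sel_congr he', sel_congr he']
    refine lt_of_le_of_lt ?_ (stair_lt_right h hc hR (k := k) (j := j') (by omega))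
    rcases h2.lt_or_eq with h3 | rfl
    · exact (h.coord_le (c.iff (hR (2 * j' + k + 1) (k + 1) (by omega)).inChain) _).2
        (stair_mono h hc hR h3 (by omega)).le
    · exact le_rfl

end Staircase

theorem exists_cut {Y : Type} [Fintype Y] {pY vY : Y → ℤ} (hpY : Function.Injective pY)
    (hvY : Function.Injective vY) (hY : NoDecreasingTriple pY vY) :
    ∃ N : ℕ, ∀ (X : Type) [Finite X] (p v : X → ℤ) (U : X → Prop) (x₀ y₀ : ℤ),
      TwoChains p v U → (∀ x, p x < x₀ → y₀ ≤ v x → U x) → (∀ x, x₀ ≤ p x → v x < y₀ → ¬ U x) →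
      (∃ x, p x < x₀ ∧ y₀ ≤ v x) → (∃ x, x₀ ≤ p x ∧ v x < y₀) →
      (∀ f : Y → X, ¬ IsPatternEmb pY vY p v f) →
      ∃ m ≤ N, m % 2 = 1 ∧ Cut p v x₀ y₀ m
        (fun x => ind (U x ∧ y₀ ≤ v x) + ind (¬ U x ∧ x₀ ≤ p x)) := by
  obtain ⟨κ, j, D, t, hbd, hκ⟩ := exists_staircase hpY hvY hY
  -- The staircase needs `3 * D + 4 * t + 6` for column `D` and height `t`; a cut uses at most twice
  -- that many lines.
  refine ⟨2 * (3 * D + 4 * t + 6), ?_⟩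
  intro X _ p v U x₀ y₀ h hNW hSE ⟨x, hx1, hx2⟩ ⟨y, hy1, hy2⟩ hav
  obtain ⟨q, ⟨hqU, hqy⟩, hqmin⟩ := Set.exists_min_image {z | U z ∧ y₀ ≤ v z} p (Set.toFinite _)
    ⟨x, hNW x hx1 hx2, hx2⟩
  obtain ⟨b, ⟨hbU, hbx⟩, hbmin⟩ := Set.exists_min_image {z | ¬ U z ∧ x₀ ≤ p z} p (Set.toFinite _)
    ⟨y, hSE y hy1 hy2, hy1⟩
  have hc : IsCorner p v U x₀ y₀ q b :=
    { q_upper := hqU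
      q_lt := (hqmin x ⟨hNW x hx1 hx2, hx2⟩).trans_lt hx1
      q_ge := hqy
      q_first := fun z hz1 hz2 => hqmin z ⟨hz1, hz2⟩
      b_lower := hbU
      b_lt := by
        have hyU := hSE y hy1 hy2
        have := (h.coord_le (x := b) (y := y) (by tauto) 1).2 (hbmin y ⟨hyU, hy1⟩)
        exact lt_of_le_of_lt (by simpa [sel] using this) hy2
      b_ge := hbx
      b_first := fun z hz1 hz2 => hbmin z ⟨hz1, hz2⟩ }
  refine (cut_or_reachSpec h hc (3 * D + 4 * t + 6)).resolve_right fun hR => ?_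
  refine hav (fun a => stair p v U q (κ a) (j a)) fun a a' => ?_
  have b1 := hbd a
  have b2 := hbd a'
  constructor
  · intro hlt
    simpa [sel] using stair_lt h hc hR (by omega) (by omega) ((hκ a a').1 hlt)
  · intro hlt
    simpa [sel] using stair_lt h hc hR (by omega) (by omega) ((hκ a a').2 hlt)

/-! ### Tame colours separating two opposite quadrants -/

/-- The colour `c` changes at most `N` times by position and at most `N` times by value. -/
def IsTame {X : Type*} (N : ℕ) (p v : X → ℤ) (c : X → ZMod 2) : Prop :=
  ∃ (ε η : ZMod 2) (A B : List ℤ), A.length ≤ N ∧ B.length ≤ N ∧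
    ∀ x, c x = ε + par A (p x) ∧ c x = η + par B (v x)

theorem IsTame.mono {X : Type*} {N N' : ℕ} (hN : N ≤ N') {p v : X → ℤ} {c : X → ZMod 2}
    (h : IsTame N p v c) : IsTame N' p v c := by
  obtain ⟨ε, η, A, B, hA, hB, hc⟩ := h
  exact ⟨ε, η, A, B, hA.trans hN, hB.trans hN, hc⟩

theorem par_neg (l : List ℤ) (z : ℤ) :
    par l (-z) = l.length + par (l.map fun a => 1 - a) z := by
  induction l with
  | nil => simp
  | cons a l ih =>
    have : ind (a ≤ -z) = 1 + ind (1 - a ≤ z) := by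
      rw [← ind_not]; congr 1; rw [eq_iff_iff]; omega
    rw [par_cons, ih, this, List.map_cons, par_cons, List.length_cons]
    push_cast; ring

theorem IsTame.neg {X : Type*} {N : ℕ} {p v : X → ℤ} {c : X → ZMod 2}
    (h : IsTame N (fun x => - p x) (fun x => - v x) c) : IsTame N p v c := by
  obtain ⟨ε, η, A, B, hA, hB, hc⟩ := h
  refine ⟨ε + A.length, η + B.length, A.map fun a => 1 - a, B.map fun a => 1 - a, by simpa,
    by simpa, fun x => ?_⟩
  rw [add_assoc, add_assoc, ← par_neg, ← par_neg]
  exact hc x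

theorem isTame_const {X : Type*} {N : ℕ} {p v : X → ℤ} (a : ZMod 2) :
    IsTame N p v (fun _ : X => a) :=
  ⟨a, a, [], [], by simp, by simp, by simp⟩

theorem NoDecreasingTriple.neg {Y : Type*} {p v : Y → ℤ} (h : NoDecreasingTriple p v) :
    NoDecreasingTriple (fun x => - p x) (fun x => - v x) := by
  intro x y z h1 h2 h3 h4
  exact h z y x (by simpa using h2) (by simpa using h1) (by simpa using h4) (by simpa using h3)

theorem TwoChains.neg {X : Type*} {p v : X → ℤ} {U : X → Prop} (h : TwoChains p v U) :
    TwoChains (fun x => - p x) (fun x => - v x) (fun x => ¬ U x) where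
  p_inj := neg_injective.comp h.p_inj
  v_inj := neg_injective.comp h.v_inj
  mono x y hU hlt := by
    have := h.mono y x (by tauto) (by simpa using hlt)
    simpa using this

theorem isPatternEmb_neg {Y X : Type*} {pY vY : Y → ℤ} {p v : X → ℤ} {f : Y → X} :
    IsPatternEmb (fun x => - pY x) (fun x => - vY x) (fun x => - p x) (fun x => - v x) f ↔
      IsPatternEmb pY vY p v f := by
  simp only [IsPatternEmb, neg_lt_neg_iff]
  exact ⟨fun h a b => h b a, fun h a b => h b a⟩

theorem zmod_two_ne_of_add {a b : ZMod 2} (h : a + b = 1) : a ≠ b := by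
  rintro rfl
  rw [CharTwo.add_self_eq_zero] at h
  exact zero_ne_one h

/-- The points to the upper left and to the lower right of a corner have a tame separation. -/
theorem exists_separation {Y : Type} [Fintype Y] {pY vY : Y → ℤ} (hpY : Function.Injective pY)
    (hvY : Function.Injective vY) (hY : NoDecreasingTriple pY vY) :
    ∃ N : ℕ, ∀ (X : Type) [Finite X] (p v : X → ℤ) (U : X → Prop) (x₀ y₀ : ℤ),
      TwoChains p v U → (∀ x y, p x < x₀ → y₀ ≤ v x → x₀ ≤ p y → v y < y₀ → U x ∧ ¬ U y) →
      (∀ f : Y → X, ¬ IsPatternEmb pY vY p v f) →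
      ∃ c : X → ZMod 2, IsTame N p v c ∧
        ∀ x y, p x < x₀ → y₀ ≤ v x → x₀ ≤ p y → v y < y₀ → c x ≠ c y := by
  obtain ⟨N₁, hN₁⟩ := exists_cut hpY hvY hY
  obtain ⟨N₂, hN₂⟩ := exists_cut (neg_injective.comp hpY) (neg_injective.comp hvY) hY.neg
  refine ⟨N₁ + N₂ + 1, ?_⟩
  intro X _ p v U x₀ y₀ h hq hav
  by_cases hex : ∃ x y, p x < x₀ ∧ y₀ ≤ v x ∧ x₀ ≤ p y ∧ v y < y₀
  swap
  · exact ⟨fun _ => 0, isTame_const 0, fun x y h1 h2 h3 h4 => absurd ⟨x, y, h1, h2, h3, h4⟩ hex⟩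
  obtain ⟨x, y, hx1, hx2, hy1, hy2⟩ := hex
  obtain ⟨m₁, hm₁, hodd₁, A₁, B₁, hlen₁, hA₁, hB₁, hδ₁⟩ := hN₁ X p v U x₀ y₀ h
    (fun z h1 h2 => (hq z y h1 h2 hy1 hy2).1) (fun z h1 h2 => (hq x z hx1 hx2 h1 h2).2)
    ⟨x, hx1, hx2⟩ ⟨y, hy1, hy2⟩ hav
  obtain ⟨m₂, hm₂, hodd₂, A₂, B₂, hlen₂, hA₂, hB₂, hδ₂⟩ := hN₂ X (fun x => - p x)
    (fun x => - v x) (fun x => ¬ U x) (1 - x₀) (1 - y₀) h.neg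
    (fun z h1 h2 => (hq x z hx1 hx2 (by omega) (by omega)).2)
    (fun z h1 h2 => not_not.2 (hq z y (by omega) (by omega) hy1 hy2).1)
    ⟨y, by omega, by omega⟩ ⟨x, by omega, by omega⟩
    (fun f hf => hav f (isPatternEmb_neg.1 hf))
  have two : (2 : ZMod 2) = 0 := rfl
  have hodd : ∀ {m : ℕ}, m % 2 = 1 → (m : ZMod 2) = 1 := fun {m} hm => by
    rw [← Nat.odd_iff] at hm; exact (ZMod.natCast_eq_one_iff_odd).2 hm
  -- The sum of the two cut equations equates a function of the position with a function of the
  -- value. This common function is the colour.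
  have key : ∀ z, ind (x₀ ≤ p z) + par A₁ (p z) + par A₂ (-p z) =
      1 + ind (y₀ ≤ v z) + par B₁ (v z) + par B₂ (-v z) := by
    intro z
    have h1 := hδ₁ z
    have h2 := hδ₂ z
    have e1 : ind (1 - y₀ ≤ - v z) = 1 + ind (y₀ ≤ v z) := by
      rw [← ind_not]; congr 1; rw [eq_iff_iff]; omega
    have e2 : ind (1 - x₀ ≤ - p z) = 1 + ind (x₀ ≤ p z) := by
      rw [← ind_not]; congr 1; rw [eq_iff_iff]; omega
    by_cases hz : U z
    · simp only [hz, true_and, not_true_eq_false, false_and, not_false_eq_true,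
        ind_of_not not_false, e2] at h1 h2
      linear_combination h1 + h2 - (par B₁ (v z) + par B₂ (-v z)) * two + ind (x₀ ≤ p z) * two
    · simp only [hz, true_and, not_true_eq_false, false_and, not_false_eq_true,
        ind_of_not not_false, e1] at h1 h2
      linear_combination h1 + h2 - (par B₁ (v z) + par B₂ (-v z)) * two + ind (x₀ ≤ p z) * two
  refine ⟨fun z => ind (x₀ ≤ p z) + par A₁ (p z) + par A₂ (-p z), ?_, ?_⟩
  · refine ⟨A₂.length, 1 + B₂.length, x₀ :: A₁ ++ A₂.map fun a => 1 - a,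
      y₀ :: B₁ ++ B₂.map fun a => 1 - a, ?_, ?_, fun z => ⟨?_, ?_⟩⟩
    · simp; omega
    · simp; omega
    · dsimp only; rw [List.cons_append, par_cons, par_append, par_neg]; ring
    · dsimp only; rw [key, List.cons_append, par_cons, par_append, par_neg]; ring
  · intro x y h1 h2 h3 h4
    obtain ⟨hUx, hUy⟩ := hq x y h1 h2 h3 h4
    apply zmod_two_ne_of_add
    have a1 := hδ₁ x
    have a2 := hδ₂ y
    simp only [hUx, h2, not_true_eq_false, false_and, ind_of_not not_false,
      ind_of trivial, and_self] at a1
    simp only [hUy, not_false_eq_true, true_and, not_true_eq_false, false_and,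
      ind_of_not not_false, show 1 - y₀ ≤ - v y by omega, ind_of trivial] at a2
    rw [par_eq_length (l := B₁) fun b hb => (hB₁ b hb).trans h2] at a1
    rw [par_eq_length (l := B₂) fun b hb => (hB₂ b hb).trans (by omega)] at a2
    dsimp only
    rw [ind_of_not (by omega : ¬ x₀ ≤ p x), ind_of h3,
      par_eq_length (l := A₂) (z := - p x) fun a ha => (hA₂ a ha).trans (by omega),
      par_eq_length (l := A₁) (z := p y) fun a ha => (hA₁ a ha).trans h3]
    -- The colours of `x` and `y` differ by 1 plus the total number of lines, and this total is even
    -- because both cuts are odd.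
    have o1 := hodd hodd₁
    have o2 := hodd hodd₂
    rw [← hlen₁] at o1
    rw [← hlen₂] at o2
    push_cast at o1 o2
    linear_combination a1 + a2 + o1 + o2 - ((B₁.length : ZMod 2) + B₂.length - 2) * two

/-! ### Least copies and the colouring -/

/-- Not preceded by a larger point. -/
def IsUpper {X : Type*} (p v : X → ℤ) (x : X) : Prop := ∀ y, p y < p x → v y < v x

theorem exists_gt_of_not_isUpper {X : Type*} {p v : X → ℤ} (hv : Function.Injective v) {x : X}
    (hx : ¬ IsUpper p v x) : ∃ y, p y < p x ∧ v x < v y := by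
  obtain ⟨y, hy⟩ := not_forall.1 hx
  rw [Classical.not_imp, not_lt] at hy
  refine ⟨y, hy.1, lt_of_le_of_ne hy.2 fun e => ?_⟩
  rw [hv e] at hy; exact lt_irrefl _ hy.1

theorem NoDecreasingTriple.twoChains {X : Type*} {p v : X → ℤ} (hp : Function.Injective p)
    (hv : Function.Injective v) (h : NoDecreasingTriple p v) : TwoChains p v (IsUpper p v) where
  p_inj := hp
  v_inj := hv
  mono x y hU hxy := by
    by_cases hy : IsUpper p v y
    · exact hy x hxy
    · obtain ⟨z, hz1, hz2⟩ := exists_gt_of_not_isUpper hv (mt hU.1 hy)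
      refine lt_of_le_of_ne (not_lt.1 fun h1 => h z x y hz1 hxy h1 hz2) fun e => ?_
      rw [hv e] at hxy; exact lt_irrefl _ hxy

theorem isTame_single {X : Type*} {p v : X → ℤ} (hp : Function.Injective p)
    (hv : Function.Injective v) (z : X) : IsTame 2 p v (fun x => ind (x = z)) := by
  have two : (2 : ZMod 2) = 0 := rfl
  have key : ∀ f : X → ℤ, Function.Injective f → ∀ x,
      ind (x = z) = 0 + par [f z, f z + 1] (f x) := by
    intro f hf x
    simp only [par_cons, par_nil]
    rcases lt_trichotomy (f x) (f z) with h | h | h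
    · rw [ind_of_not (by rintro rfl; exact lt_irrefl _ h), ind_of_not (by omega),
        ind_of_not (by omega)]; ring
    · rw [ind_of (hf h), ind_of (by omega), ind_of_not (by omega)]; ring
    · rw [ind_of_not (by rintro rfl; exact lt_irrefl _ h), ind_of (by omega),
        ind_of (by omega)]; linear_combination - two
  exact ⟨0, 0, [p z, p z + 1], [v z, v z + 1], by simp, by simp,
    fun x => ⟨key p hp x, key v hv x⟩⟩

-- Copies of one type are closed under pointwise minimum, since within a chain the same point is
-- smaller in both coordinates. A copy with the least sum of positions is therefore below all
-- others.
open Classical in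
theorem exists_least_emb {Y X : Type*} [Finite Y] [Finite X] {pY vY : Y → ℤ} {p v : X → ℤ}
    {U : X → Prop} (h : TwoChains p v U) (τ : Y → Prop)
    (hex : ∃ f : Y → X, IsPatternEmb pY vY p v f ∧ ∀ a, U (f a) ↔ τ a) :
    ∃ f : Y → X, IsPatternEmb pY vY p v f ∧ (∀ a, U (f a) ↔ τ a) ∧
      ∀ g : Y → X, IsPatternEmb pY vY p v g → (∀ a, U (g a) ↔ τ a) →
        ∀ a, p (f a) ≤ p (g a) ∧ v (f a) ≤ v (g a) := by
  have := Fintype.ofFinite Y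
  obtain ⟨f, ⟨hf, hfτ⟩, hmin⟩ := Set.exists_min_image
    {f : Y → X | IsPatternEmb pY vY p v f ∧ ∀ a, U (f a) ↔ τ a} (fun f => ∑ a, p (f a))
    (Set.toFinite _) hex
  refine ⟨f, hf, hfτ, fun g hg hgτ => ?_⟩
  have hpv : ∀ a, p (f a) ≤ p (g a) ↔ v (f a) ≤ v (g a) := fun a => by
    have := h.coord_le (x := f a) (y := g a) (by rw [hfτ, hgτ]) 1
    simpa [sel] using this.symm
  let m : Y → X := fun a => if p (f a) ≤ p (g a) then f a else g a
  have mp : ∀ a, p (m a) = min (p (f a)) (p (g a)) := fun a => by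
    simp only [m]; split_ifs with h1
    · exact (min_eq_left h1).symm
    · exact (min_eq_right (not_le.1 h1).le).symm
  have mv : ∀ a, v (m a) = min (v (f a)) (v (g a)) := fun a => by
    simp only [m, hpv]; split_ifs with h1
    · exact (min_eq_left h1).symm
    · exact (min_eq_right (not_le.1 h1).le).symm
  have hm : IsPatternEmb pY vY p v m := by
    intro a b
    rw [mp, mp, mv, mv]
    exact ⟨fun hab => min_lt_min ((hf a b).1 hab) ((hg a b).1 hab),
      fun hab => min_lt_min ((hf a b).2 hab) ((hg a b).2 hab)⟩
  have hmτ : ∀ a, U (m a) ↔ τ a := fun a => by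
    simp only [m]; split_ifs
    · exact hfτ a
    · exact hgτ a
  have hle : ∀ a ∈ Finset.univ, p (m a) ≤ p (f a) := fun a _ => by
    rw [mp]; exact min_le_left _ _
  have heq := (Finset.sum_eq_sum_iff_of_le hle).1
    (le_antisymm (Finset.sum_le_sum hle) (hmin m ⟨hm, hmτ⟩))
  intro a
  have h1 : p (f a) ≤ p (g a) := by
    rw [← heq a (Finset.mem_univ a), mp]; exact min_le_right _ _
  exact ⟨h1, (hpv a).1 h1⟩

/-- The point `a₀` is an articulation point. -/
def IsCutPoint {Y : Type*} (pY vY : Y → ℤ) (a₀ : Y) : Prop :=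
  ∀ a, (pY a < pY a₀ → vY a < vY a₀) ∧ (pY a₀ < pY a → vY a₀ < vY a)

section Glue
variable {Y X : Type*} {pY vY : Y → ℤ} {p v : X → ℤ} {a₀ : Y}

open Classical in
/-- Insert the point `P` between the lower part of one copy and the upper part of another one. -/
theorem exists_emb_of_between (hpY : Function.Injective pY) (ha₀ : IsCutPoint pY vY a₀)
    {f g : {a // a ≠ a₀} → X}
    (hf : IsPatternEmb (fun a => pY a.1) (fun a => vY a.1) p v f)
    (hg : IsPatternEmb (fun a => pY a.1) (fun a => vY a.1) p v g) (P : X)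
    (hlow : ∀ a : {a // a ≠ a₀}, pY a < pY a₀ → p (f a) < p P ∧ v (f a) < v P)
    (hupp : ∀ a : {a // a ≠ a₀}, pY a₀ < pY a → p P < p (g a) ∧ v P < v (g a)) :
    ∃ F : Y → X, IsPatternEmb pY vY p v F := by
  let F : Y → X := fun a =>
    if h : a = a₀ then P else if pY a < pY a₀ then f ⟨a, h⟩ else g ⟨a, h⟩
  have F0 : F a₀ = P := by simp [F]
  have F1 : ∀ a (h : a ≠ a₀), pY a < pY a₀ → F a = f ⟨a, h⟩ := fun a h h1 => by simp [F, h, h1]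
  have F2 : ∀ a (h : a ≠ a₀), pY a₀ < pY a → F a = g ⟨a, h⟩ := fun a h h1 => by
    simp [F, h, h1.le, not_lt]
  have vp : ∀ a b, a = a₀ ∨ b = a₀ → vY a < vY b → pY a < pY b := by
    rintro a b h hab
    rcases lt_trichotomy (pY a) (pY b) with h1 | h1 | h1
    · exact h1
    · rw [hpY h1] at hab; exact absurd hab (lt_irrefl _)
    · rcases h with rfl | rfl
      · exact absurd ((ha₀ b).1 h1) hab.asymm
      · exact absurd ((ha₀ a).2 h1) hab.asymm
  have key : ∀ a b, (a = a₀ ∨ b = a₀ ∨ (pY a < pY a₀ ∧ pY a₀ < pY b)) → pY a < pY b →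
      p (F a) < p (F b) ∧ v (F a) < v (F b) := by
    intro a b h hab
    by_cases ha : a = a₀
    · subst ha
      have hb : b ≠ a := by rintro rfl; exact lt_irrefl _ hab
      rw [F0, F2 b hb hab]; exact hupp ⟨b, hb⟩ hab
    · by_cases hb : b = a₀
      · subst hb
        rw [F0, F1 a ha hab]; exact hlow ⟨a, ha⟩ hab
      · obtain ⟨h1, h2⟩ : pY a < pY a₀ ∧ pY a₀ < pY b := by tauto
        rw [F1 a ha h1, F2 b hb h2]
        exact ⟨(hlow ⟨a, ha⟩ h1).1.trans (hupp ⟨b, hb⟩ h2).1,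
          (hlow ⟨a, ha⟩ h1).2.trans (hupp ⟨b, hb⟩ h2).2⟩
  refine ⟨F, fun a b => ?_⟩
  by_cases h : a = a₀ ∨ b = a₀
  · exact ⟨fun hab => (key a b (by tauto) hab).1, fun hab => (key a b (by tauto) (vp a b h hab)).2⟩
  push Not at h
  rcases lt_or_gt_of_ne (fun e => h.1 (hpY e)) with ha | ha <;>
    rcases lt_or_gt_of_ne (fun e => h.2 (hpY e)) with hb | hb
  · rw [F1 a h.1 ha, F1 b h.2 hb]; exact hf ⟨a, h.1⟩ ⟨b, h.2⟩
  · have := key a b (Or.inr (Or.inr ⟨ha, hb⟩)) (ha.trans hb)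
    exact ⟨fun _ => this.1, fun _ => this.2⟩
  · refine ⟨fun hab => absurd (ha.trans hab) hb.asymm, fun hab => ?_⟩
    exact absurd (((ha₀ a).2 ha).trans hab) ((ha₀ b).1 hb).asymm
  · rw [F2 a h.1 ha, F2 b h.2 hb]; exact hg ⟨a, h.1⟩ ⟨b, h.2⟩

end Glue

/-- The colouring `col` splits the points into classes which have at most one element or do not
contain the pattern `Y`. -/
def Splits {Y X ι : Type*} (pY vY : Y → ℤ) (p v : X → ℤ) (col : ι → X → ZMod 2) : Prop :=
  ∀ κ : ι → ZMod 2, {x | ∀ r, col r x = κ r}.Subsingleton ∨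
    ∀ f : Y → X, IsPatternEmb pY vY p v f → ¬ ∀ a r, col r (f a) = κ r

theorem exists_coloring_of_lower {Y : Type} [Finite Y] {pY vY : Y → ℤ}
    (hpY : Function.Injective pY) (hvY : Function.Injective vY) (hY : NoDecreasingTriple pY vY)
    {a₀ : Y} (ha₀ : IsCutPoint pY vY a₀) (hlow : ∃ a, pY a < pY a₀) :
    ∃ (ι : Type) (_ : Finite ι) (N : ℕ), ∀ (X : Type) [Finite X] (p v : X → ℤ),
      Function.Injective p → Function.Injective v → NoDecreasingTriple p v →
      (∀ f : Y → X, ¬ IsPatternEmb pY vY p v f) →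
      ∃ col : ι → X → ZMod 2, (∀ r, IsTame N p v (col r)) ∧
        Splits (fun a : {a // a ≠ a₀} => pY a) (fun a : {a // a ≠ a₀} => vY a) p v col := by
  have := Fintype.ofFinite Y
  obtain ⟨N, hN⟩ := exists_separation hpY hvY hY
  -- Each type `τ` gets three colours: two isolate the extreme elements `f al` and `f at'` of the
  -- least copy, and the third separates the quadrants at the corner just beyond them.
  refine ⟨({a // a ≠ a₀} → Prop) × Fin 3, inferInstance, max N 2, ?_⟩
  intro X _ p v hp hv hX hav
  have hlow' : {a : {a // a ≠ a₀} | pY a < pY a₀}.Nonempty := by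
    obtain ⟨a, ha⟩ := hlow
    exact ⟨⟨a, by rintro rfl; exact lt_irrefl _ ha⟩, ha⟩
  obtain ⟨al, hal, halmax⟩ := Set.exists_max_image _ (fun a : {a // a ≠ a₀} => pY a)
    (Set.toFinite _) hlow'
  obtain ⟨at', hat, hatmax⟩ := Set.exists_max_image _ (fun a : {a // a ≠ a₀} => vY a)
    (Set.toFinite _) hlow'
  have hT := hX.twoChains hp hv
  have main : ∀ τ : {a // a ≠ a₀} → Prop, ∃ c : Fin 3 → X → ZMod 2,
      (∀ i, IsTame (max N 2) p v (c i)) ∧ ∀ g : {a // a ≠ a₀} → X,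
        IsPatternEmb (fun a => pY a.1) (fun a => vY a.1) p v g →
        (∀ a, IsUpper p v (g a) ↔ τ a) → (∀ a b i, c i (g a) = c i (g b)) →
        ∃ i a, ∀ x y, c i x = c i (g a) → c i y = c i (g a) → x = y := by
    intro τ
    by_cases hex : ∃ f : {a // a ≠ a₀} → X,
      IsPatternEmb (fun a => pY a.1) (fun a => vY a.1) p v f ∧ ∀ a, IsUpper p v (f a) ↔ τ a
    swap
    · exact ⟨fun _ _ => 0, fun _ => isTame_const 0, fun g hg hgτ _ => absurd ⟨g, hg, hgτ⟩ hex⟩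
    obtain ⟨f, hf, hfτ, hmin⟩ := exists_least_emb hT τ hex
    obtain ⟨c, hc, hsep⟩ := hN X p v (IsUpper p v) (p (f al) + 1) (v (f at') + 1) hT
      (fun x y h1 h2 h3 h4 => ⟨fun z hz => by
        by_contra hcon
        rcases (not_lt.1 hcon).lt_or_eq with h5 | h5
        · exact hX z x y hz (by omega) (by omega) h5
        · rw [hv h5] at hz; exact lt_irrefl _ hz,
        fun hy => by have := hy x (by omega); omega⟩) hav
    refine ⟨![fun x => ind (x = f al), fun x => ind (x = f at'), c], ?_, ?_⟩
    · intro i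
      fin_cases i
      · exact (isTame_single hp hv _).mono (le_max_right _ _)
      · exact (isTame_single hp hv _).mono (le_max_right _ _)
      · exact hc.mono (le_max_left _ _)
    intro g hg hgτ hmono
    have single : ∀ w x u : X, u = w → ind (x = w) = ind (u = w) → x = w := fun w x u hu h1 => by
      by_contra h2; rw [ind_of_not h2, ind_of hu] at h1; exact zero_ne_one h1
    by_cases e1 : g al = f al
    · exact ⟨0, al, fun x y hx hy => (single _ x _ e1 hx).trans (single _ y _ e1 hy).symm⟩
    by_cases e2 : g at' = f at'
    · exact ⟨1, at', fun x y hx hy => (single _ x _ e2 hx).trans (single _ y _ e2 hy).symm⟩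
    exfalso
    have l1 : p (f al) < p (g al) :=
      lt_of_le_of_ne (hmin g hg hgτ al).1 fun e => e1 (hp e).symm
    have l2 : v (f at') < v (g at') :=
      lt_of_le_of_ne (hmin g hg hgτ at').2 fun e => e2 (hv e).symm
    have fle : ∀ a : {a // a ≠ a₀}, pY a < pY a₀ → p (f a) ≤ p (f al) ∧ v (f a) ≤ v (f at') := by
      intro a ha
      constructor
      · rcases (halmax a ha).lt_or_eq with h1 | h1
        · exact ((hf a al).1 h1).le
        · rw [Subtype.ext (hpY h1)]
      · rcases (hatmax a ha).lt_or_eq with h1 | h1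
        · exact ((hf a at').2 h1).le
        · rw [Subtype.ext (hvY h1)]
    -- Here `g w` would take the place of `a₀` between the lower part of `f` and the upper part of
    -- `g`.
    have below : ∀ w : {a // a ≠ a₀}, pY w < pY a₀ → p (f al) < p (g w) → v (f at') < v (g w) →
        False := by
      intro w hw h1 h2
      obtain ⟨F, hF⟩ := exists_emb_of_between hpY ha₀ hf hg (g w)
        (fun a ha => ⟨(fle a ha).1.trans_lt h1, (fle a ha).2.trans_lt h2⟩)
        (fun a ha => ⟨(hg w a).1 (hw.trans ha),
          (hg w a).2 (((ha₀ w).1 hw).trans ((ha₀ a).2 ha))⟩)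
      exact hav F hF
    have l3 : v (g al) < v (f at') + 1 := by
      by_contra hcon; exact below al hal l1 (by omega)
    have l4 : p (g at') < p (f al) + 1 := by
      by_contra hcon; exact below at' hat (by omega) l2
    exact hsep (g at') (g al) l4 (by omega) (by omega) l3 (hmono at' al 2)
  choose c hc hmain using main
  refine ⟨fun r => c r.1 r.2, fun r => hc r.1 r.2, fun κ => ?_⟩
  refine or_iff_not_imp_right.2 fun hex => ?_
  push Not at hex
  obtain ⟨g, hg, hgκ⟩ := hex
  obtain ⟨i, a, hi⟩ := hmain (fun a => IsUpper p v (g a)) g hg (fun a => Iff.rfl)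
    (fun a b i => (hgκ a (_, i)).trans (hgκ b (_, i)).symm)
  intro x hx y hy
  exact hi x y ((hx (_, i)).trans (hgκ a (_, i)).symm) ((hy (_, i)).trans (hgκ a (_, i)).symm)

/-- If nothing precedes `a₀`, both axes are reversed. If nothing follows it either, `Y` is one point
and `X` is empty. -/
theorem exists_coloring {Y : Type} [Finite Y] {pY vY : Y → ℤ}
    (hpY : Function.Injective pY) (hvY : Function.Injective vY) (hY : NoDecreasingTriple pY vY)
    {a₀ : Y} (ha₀ : IsCutPoint pY vY a₀) :
    ∃ (ι : Type) (_ : Finite ι) (N : ℕ), ∀ (X : Type) [Finite X] (p v : X → ℤ),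
      Function.Injective p → Function.Injective v → NoDecreasingTriple p v →
      (∀ f : Y → X, ¬ IsPatternEmb pY vY p v f) →
      ∃ col : ι → X → ZMod 2, (∀ r, IsTame N p v (col r)) ∧
        Splits (fun a : {a // a ≠ a₀} => pY a) (fun a : {a // a ≠ a₀} => vY a) p v col := by
  by_cases h1 : ∃ a, pY a < pY a₀
  · exact exists_coloring_of_lower hpY hvY hY ha₀ h1
  by_cases h2 : ∃ a, pY a₀ < pY a
  · obtain ⟨a, ha⟩ := h2
    obtain ⟨ι, hι, N, H⟩ := exists_coloring_of_lower (neg_injective.comp hpY)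
      (neg_injective.comp hvY) hY.neg (a₀ := a₀)
      (fun a => ⟨fun h => neg_lt_neg ((ha₀ a).2 (neg_lt_neg_iff.1 h)),
        fun h => neg_lt_neg ((ha₀ a).1 (neg_lt_neg_iff.1 h))⟩) ⟨a, neg_lt_neg ha⟩
    refine ⟨ι, hι, N, fun X _ p v hp hv hX hav => ?_⟩
    obtain ⟨col, hcol, hs⟩ := H X (fun x => - p x) (fun x => - v x) (neg_injective.comp hp)
      (neg_injective.comp hv) hX.neg (fun f hf => hav f (isPatternEmb_neg.1 hf))
    exact ⟨col, fun r => (hcol r).neg, fun κ =>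
      (hs κ).imp_right fun h f hf => h f (isPatternEmb_neg.2 hf)⟩
  · push Not at h1 h2
    have hY : ∀ a, a = a₀ := fun a => hpY (le_antisymm (h2 a) (h1 a))
    refine ⟨Empty, inferInstance, 0, fun X _ p v hp hv hX hav => ⟨fun r => r.elim,
      fun r => r.elim, fun κ => Or.inl fun x _ => ?_⟩⟩
    exact absurd (fun a b => by rw [hY a, hY b]; simp) (hav fun _ => x)

/-! ### Counting bounded merges -/

/-- The number of permutations of length `n` in `C`. -/
noncomputable def levelCard (C : Set FinPerm) (n : ℕ) : ℕ :=
  {π : Equiv.Perm (Fin n) | (⟨n, π⟩ : FinPerm) ∈ C}.ncard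

theorem growthRate_le_of_eventually {C : Set FinPerm} {t : ℝ} (ht : 0 ≤ t)
    (h : ∀ᶠ n in Filter.atTop, (levelCard C n : ℝ) ≤ t ^ n) :
    growthRate C ≤ ENNReal.ofReal t := by
  refine Filter.limsup_le_of_le (h := ?_)
  filter_upwards [h, Filter.eventually_gt_atTop 0] with n hn hn0
  change ((levelCard C n : ℕ) : ℝ≥0∞) ^ (1 / (n : ℝ)) ≤ _
  have h1 : ((levelCard C n : ℕ) : ℝ≥0∞) ≤ ENNReal.ofReal t ^ (n : ℝ) := by
    rw [ENNReal.rpow_natCast, ← ENNReal.ofReal_pow ht, ← ENNReal.ofReal_natCast]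
    exact ENNReal.ofReal_le_ofReal hn
  calc _ ≤ (ENNReal.ofReal t ^ (n : ℝ)) ^ (1 / (n : ℝ)) :=
        ENNReal.rpow_le_rpow h1 (by positivity)
    _ = ENNReal.ofReal t := by
        rw [← ENNReal.rpow_mul, mul_one_div_cancel (by positivity), ENNReal.rpow_one]

theorem eventually_le_of_growthRate_lt {C : Set FinPerm} {t : ℝ}
    (h : growthRate C < ENNReal.ofReal t) :
    ∀ᶠ n in Filter.atTop, (levelCard C n : ℝ) ≤ t ^ n := by
  have ht : 0 < t := ENNReal.ofReal_pos.1 (bot_le.trans_lt h)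
  filter_upwards [Filter.eventually_lt_of_limsup_lt h, Filter.eventually_gt_atTop 0]
    with n hn hn0
  change ((levelCard C n : ℕ) : ℝ≥0∞) ^ (1 / (n : ℝ)) < _ at hn
  have h1 := ENNReal.rpow_le_rpow hn.le (Nat.cast_nonneg (α := ℝ) n)
  rw [← ENNReal.rpow_mul, one_div_mul_cancel (by positivity), ENNReal.rpow_one,
    ENNReal.rpow_natCast, ← ENNReal.ofReal_pow ht.le, ← ENNReal.ofReal_natCast] at h1
  exact (ENNReal.ofReal_le_ofReal_iff (by positivity)).1 h1

theorem growthRate_mono {C D : Set FinPerm} (h : C ⊆ D) : growthRate C ≤ growthRate D := by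
  refine Filter.limsup_le_limsup (Filter.Eventually.of_forall fun n => ?_)
  refine ENNReal.rpow_le_rpow ?_ (by positivity)
  have : {π : Equiv.Perm (Fin n) | (⟨n, π⟩ : FinPerm) ∈ C} ⊆ {π | (⟨n, π⟩ : FinPerm) ∈ D} :=
    fun π hπ => h hπ
  exact_mod_cast Set.ncard_le_ncard this (Set.toFinite _)

/-- The `n`-letter words which change at most `N` times. -/
def tameWords (N n : ℕ) : Set (Fin n → ZMod 2) :=
  {w | ∃ (ε : ZMod 2) (l : List ℤ), l.length ≤ N ∧ ∀ i, w i = ε + par l (i : ℕ)}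

theorem ncard_tameWords_le (N n : ℕ) : (tameWords N n).ncard ≤ 2 * (n + 1) ^ N := by
  induction N with
  | zero =>
    have : tameWords 0 n ⊆ Set.range fun (ε : ZMod 2) (_ : Fin n) => ε := by
      rintro w ⟨ε, l, hl, hw⟩
      obtain rfl : l = [] := List.length_eq_zero_iff.1 (by omega)
      exact ⟨ε, by funext i; simp [hw]⟩
    refine (Set.ncard_le_ncard this (Set.toFinite _)).trans ?_
    rw [← Set.image_univ]
    refine (Set.ncard_image_le (Set.toFinite _)).trans ?_
    simp [Set.ncard_univ]
  | succ N ih =>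
    have : tameWords (N + 1) n ⊆ (fun x : (Fin n → ZMod 2) × Fin (n + 1) =>
        fun i : Fin n => x.1 i + ind ((x.2 : ℕ) ≤ (i : ℕ))) '' (tameWords N n ×ˢ Set.univ) := by
      rintro w ⟨ε, l, hl, hw⟩
      rcases l with _ | ⟨b, l⟩
      · refine ⟨(w, Fin.last n), ⟨⟨ε, [], by simp, hw⟩, trivial⟩, ?_⟩
        funext i
        have := i.2
        simp only [Fin.val_last]
        rw [ind_of_not (by omega), add_zero]
      -- Only the place of the line `b` among `0, ..., n` affects the word.
      · refine ⟨(fun i => ε + par l (i : ℕ), ⟨min n b.toNat, by omega⟩),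
          ⟨⟨ε, l, by simpa using hl, fun _ => rfl⟩, trivial⟩, ?_⟩
        funext i
        rw [hw, par_cons]
        have : (min n b.toNat ≤ (i : ℕ)) = (b ≤ ((i : ℕ) : ℤ)) := by
          rw [eq_iff_iff]; have := i.2; omega
        simp only [this]
        ring
    refine (Set.ncard_le_ncard this (Set.toFinite _)).trans
      ((Set.ncard_image_le (Set.toFinite _)).trans ?_)
    rw [Set.ncard_prod, Set.ncard_univ, Nat.card_eq_fintype_card, Fintype.card_fin, pow_succ,
      ← mul_assoc]
    exact Nat.mul_le_mul_right _ ih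

theorem lt_iff_of_patternOn_eq {n : ℕ} {π π' : Equiv.Perm (Fin n)} {S : Finset (Fin n)}
    (h : patternOn ⟨n, π⟩ S = patternOn ⟨n, π'⟩ S) {i j : Fin n} (hi : i ∈ S) (hj : j ∈ S) :
    π i < π j ↔ π' i < π' j := by
  have h2 : (patternOn ⟨n, π⟩ S).2 = (patternOn ⟨n, π'⟩ S).2 := eq_of_heq (Sigma.ext_iff.1 h).2
  obtain ⟨a, rfl⟩ : ∃ a, S.orderEmbOfFin rfl a = i := by
    have : i ∈ Set.range (S.orderEmbOfFin rfl) := by simpa using hi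
    exact this
  obtain ⟨b, rfl⟩ : ∃ b, S.orderEmbOfFin rfl b = j := by
    have : j ∈ Set.range (S.orderEmbOfFin rfl) := by simpa using hj
    exact this
  rw [← patternOn_lt_iff ⟨n, π⟩ S a b, ← patternOn_lt_iff ⟨n, π'⟩ S a b, h2]
  exact Iff.rfl

/-- The set `V` of values of the class of `i` is known from the colours by value, and the rank of `π
i` in `V` from the pattern of the class. -/
theorem perm_eq_of_classes {n : ℕ} {κ : Type*} [DecidableEq κ] {π π' : Equiv.Perm (Fin n)}
    (c : Fin n → κ) (hv : ∀ x, c (π.symm x) = c (π'.symm x))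
    (h : ∀ k, patternOn ⟨n, π⟩ (Finset.univ.filter fun i => c i = k) =
      patternOn ⟨n, π'⟩ (Finset.univ.filter fun i => c i = k)) : π = π' := by
  ext i
  set S := Finset.univ.filter fun j => c j = c i with hS
  have hcmp : ∀ j ∈ S, (π j < π i ↔ π' j < π' i) := fun j hj =>
    lt_iff_of_patternOn_eq (h (c i)) hj (by simp)
  let V := Finset.univ.filter fun x => c (π.symm x) = c i
  have hcard : ∀ ρ : Equiv.Perm (Fin n), (∀ x, c (ρ.symm x) = c (π.symm x)) →
      (V.filter (· < ρ i)).card = (S.filter fun j => ρ j < ρ i).card := by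
    intro ρ hρ
    refine Finset.card_bij' (fun x _ => ρ.symm x) (fun j _ => ρ j) ?_ ?_ (by simp) (by simp)
    · intro x hx
      simp only [V, Finset.mem_filter, Finset.mem_univ, true_and] at hx
      simp only [hS, Finset.mem_filter, Finset.mem_univ, true_and, Equiv.apply_symm_apply, hρ]
      exact hx
    · intro j hj
      simp only [hS, Finset.mem_filter, Finset.mem_univ, true_and] at hj
      simp only [V, Finset.mem_filter, Finset.mem_univ, true_and, ← hρ, Equiv.symm_apply_apply]
      exact hj
  have e1 := hcard π fun _ => rfl
  have e2 := hcard π' fun x => (hv x).symm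
  rw [Finset.filter_congr hcmp, ← e2] at e1
  have hlt : ∀ a b, a ∈ V → a < b → (V.filter (· < a)).card < (V.filter (· < b)).card := by
    intro a b ha hab
    refine Finset.card_lt_card (Finset.ssubset_iff_subset_ne.2 ⟨?_, fun e => ?_⟩)
    · exact Finset.monotone_filter_right _ fun x _ hx => lt_trans hx hab
    · have : a ∈ V.filter (· < b) := Finset.mem_filter.2 ⟨ha, hab⟩
      rw [← e] at this
      exact lt_irrefl _ (Finset.mem_filter.1 this).2
  have m1 : π i ∈ V := by simp [V]
  have m2 : π' i ∈ V := by simp [V, hv]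
  rcases lt_trichotomy (π i) (π' i) with h1 | h1 | h1
  · exact absurd e1 (hlt _ _ m1 h1).ne
  · rw [h1]
  · exact absurd e1 (hlt _ _ m2 h1).ne'

open Classical in
/-- The members of `K` and the permutations of length at most one, up to length `n`. -/
noncomputable def upTo (K : Set FinPerm) (n : ℕ) : Finset FinPerm :=
  (Finset.range (n + 1)).sigma fun m =>
    Finset.univ.filter fun σ : Equiv.Perm (Fin m) => (⟨m, σ⟩ : FinPerm) ∈ K ∨ m ≤ 1

theorem mem_upTo {K : Set FinPerm} {n : ℕ} {σ : FinPerm} :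
    σ ∈ upTo K n ↔ σ.1 ≤ n ∧ (σ ∈ K ∨ σ.1 ≤ 1) := by
  simp [upTo]

/-- With weight `(t⁻¹) ^ length`, every sufficiently large length contributes at most 1. -/
theorem sum_upTo_le {K : Set FinPerm} {t : ℝ} (ht : 0 < t)
    (hK : ∀ᶠ n in Filter.atTop, (levelCard K n : ℝ) ≤ t ^ n) :
    ∃ C : ℝ, 0 ≤ C ∧ ∀ n, ∑ σ ∈ upTo K n, (t⁻¹) ^ σ.1 ≤ (n + 1) * C := by
  classical
  obtain ⟨m₀, hm₀⟩ := Filter.eventually_atTop.1 hK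
  let f : ℕ → ℝ := fun m => ((Finset.univ.filter fun σ : Equiv.Perm (Fin m) =>
    (⟨m, σ⟩ : FinPerm) ∈ K ∨ m ≤ 1).card : ℝ) * (t⁻¹) ^ m
  have hf : ∀ m, 0 ≤ f m := fun m => by positivity
  have hC0 : 0 ≤ ∑ m ∈ Finset.range (m₀ + 2), f m := Finset.sum_nonneg fun m _ => hf m
  refine ⟨1 + ∑ m ∈ Finset.range (m₀ + 2), f m, by positivity, fun n => ?_⟩
  have hbound : ∀ m, f m ≤ 1 + ∑ m ∈ Finset.range (m₀ + 2), f m := by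
    intro m
    by_cases hm : m < m₀ + 2
    · have := Finset.single_le_sum (fun m _ => hf m) (Finset.mem_range.2 hm)
      linarith
    · have h1 := hm₀ m (by omega)
      have h2 : (Finset.univ.filter fun σ : Equiv.Perm (Fin m) =>
          (⟨m, σ⟩ : FinPerm) ∈ K ∨ m ≤ 1).card = levelCard K m := by
        rw [levelCard, ← Set.ncard_coe_finset]
        congr 1
        ext σ
        simp [show ¬ m ≤ 1 by omega]
      have h3 : f m ≤ 1 := by
        simp only [f]
        rw [h2, inv_pow, ← div_eq_mul_inv]
        exact (div_le_one (by positivity)).2 h1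
      linarith
  calc ∑ σ ∈ upTo K n, (t⁻¹) ^ σ.1 = ∑ m ∈ Finset.range (n + 1), f m := by
        rw [upTo, Finset.sum_sigma]
        exact Finset.sum_congr rfl fun m _ => by simp [f]
    _ ≤ ∑ m ∈ Finset.range (n + 1), (1 + ∑ m ∈ Finset.range (m₀ + 2), f m) :=
        Finset.sum_le_sum fun m _ => hbound m
    _ = _ := by simp; ring

/-- `Z` consists of bounded merges of members of `K` and single elements. -/
def IsBoundedMerge (ι : Type) (N : ℕ) (Z K : Set FinPerm) : Prop :=
  ∀ π ∈ Z, ∃ c : Fin π.1 → ι → ZMod 2,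
    (∀ r, IsTame N (fun i : Fin π.1 => ((i : ℕ) : ℤ)) (fun i => ((π.2 i : ℕ) : ℤ))
      fun i => c i r) ∧
    ∀ (κ : ι → ZMod 2) (S : Finset (Fin π.1)), (∀ i, i ∈ S ↔ c i = κ) →
      patternOn π S ∈ K ∨ S.card ≤ 1

-- The lengths of the classes add up to `n`, so the weight is multiplicative over the classes, and
-- the sum over all codes factors.
open Classical in
theorem levelCard_le_of_isBoundedMerge {ι : Type} [Fintype ι] {N : ℕ} {Z K : Set FinPerm}
    (h : IsBoundedMerge ι N Z K) (t : ℝ) (ht : 0 < t) (n : ℕ) :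
    (levelCard Z n : ℝ) * (t⁻¹) ^ n ≤
      (((2 * (n + 1) ^ N : ℕ) : ℝ) ^ Fintype.card ι) ^ 2 *
        (∑ σ ∈ upTo K n, (t⁻¹) ^ σ.1) ^ Fintype.card (ι → ZMod 2) := by
  let Zn : Finset (Equiv.Perm (Fin n)) := Finset.univ.filter fun π => (⟨n, π⟩ : FinPerm) ∈ Z
  have hZn : levelCard Z n = Zn.card := by
    rw [levelCard, ← Set.ncard_coe_finset]; congr 1; ext π; simp [Zn]
  have hcol : ∀ π : Equiv.Perm (Fin n), ∃ c : Fin n → ι → ZMod 2, (⟨n, π⟩ : FinPerm) ∈ Z →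
      (∀ r, IsTame N (fun i : Fin n => ((i : ℕ) : ℤ)) (fun i => ((π i : ℕ) : ℤ))
        fun i => c i r) ∧
      ∀ (κ : ι → ZMod 2) (S : Finset (Fin n)), (∀ i, i ∈ S ↔ c i = κ) →
        patternOn ⟨n, π⟩ S ∈ K ∨ S.card ≤ 1 := by
    intro π
    by_cases hπ : (⟨n, π⟩ : FinPerm) ∈ Z
    · obtain ⟨c, hc⟩ := h _ hπ
      exact ⟨c, fun _ => hc⟩
    · exact ⟨fun _ _ => 0, fun h => absurd h hπ⟩
  choose c hc using hcol
  let W : Finset (Fin n → ZMod 2) := (Set.toFinite (tameWords N n)).toFinset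
  have hW : W.card ≤ 2 * (n + 1) ^ N := by
    rw [← Set.ncard_eq_toFinset_card]; exact ncard_tameWords_le N n
  let cls : Equiv.Perm (Fin n) → (ι → ZMod 2) → Finset (Fin n) := fun π κ =>
    Finset.univ.filter fun i => c π i = κ
  let pat : Equiv.Perm (Fin n) → (ι → ZMod 2) → FinPerm := fun π κ =>
    patternOn ⟨n, π⟩ (cls π κ)
  let code : Equiv.Perm (Fin n) → ((ι → Fin n → ZMod 2) × (ι → Fin n → ZMod 2)) ×
      ((ι → ZMod 2) → FinPerm) := fun π =>
    ((fun r i => c π i r, fun r x => c π (π.symm x) r), pat π)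
  have hinj : ∀ π π', code π = code π' → π = π' := by
    intro π π' e
    have e1 : c π = c π' := by
      funext i r
      exact congrFun (congrFun (congrArg (fun x => x.1.1) e) r) i
    have e2 : ∀ x, c π (π.symm x) = c π (π'.symm x) := by
      intro x
      have : c π (π.symm x) = c π' (π'.symm x) := by
        funext r
        exact congrFun (congrFun (congrArg (fun x => x.1.2) e) r) x
      rw [this, e1]
    refine perm_eq_of_classes (c π) e2 fun κ => ?_
    have e3 : pat π κ = pat π' κ := congrFun (congrArg (fun x => x.2) e) κ
    simp only [pat, cls] at e3
    rw [e1] at e3 ⊢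
    exact e3
  let B := (Fintype.piFinset (fun _ : ι => W) ×ˢ Fintype.piFinset (fun _ : ι => W)) ×ˢ
    Fintype.piFinset (fun _ : ι → ZMod 2 => upTo K n)
  have hmem : ∀ π ∈ Zn, code π ∈ B := by
    intro π hπ
    obtain ⟨h1, h2⟩ := hc π (by simpa [Zn] using hπ)
    refine Finset.mem_product.2 ⟨Finset.mem_product.2 ⟨Fintype.mem_piFinset.2 fun r => ?_,
      Fintype.mem_piFinset.2 fun r => ?_⟩, Fintype.mem_piFinset.2 fun κ => ?_⟩
    · obtain ⟨ε, η, A, B, hA, hB, hAB⟩ := h1 r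
      exact (Set.Finite.mem_toFinset _).2 ⟨ε, A, hA, fun i => (hAB i).1⟩
    · obtain ⟨ε, η, A, B, hA, hB, hAB⟩ := h1 r
      refine (Set.Finite.mem_toFinset _).2 ⟨η, B, hB, fun x => ?_⟩
      have := (hAB (π.symm x)).2
      simpa [code] using this
    · refine mem_upTo.2 ⟨?_, h2 κ (cls π κ) (fun i => by simp [cls])⟩
      exact (Finset.card_le_univ (cls π κ)).trans (by simp)
  have hlen : ∀ π, ∏ κ, (t⁻¹) ^ (pat π κ).1 = (t⁻¹) ^ n := by
    intro π
    rw [Finset.prod_pow_eq_pow_sum]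
    congr 1
    change ∑ κ, (cls π κ).card = n
    rw [← Finset.card_eq_sum_card_fiberwise (s := Finset.univ) (t := Finset.univ)
      (f := c π) (by simp)]
    simp
  have ht' : 0 ≤ t⁻¹ := by positivity
  calc (levelCard Z n : ℝ) * (t⁻¹) ^ n
      = ∑ π ∈ Zn, ∏ κ, (t⁻¹) ^ ((code π).2 κ).1 := by
        rw [hZn, Finset.sum_congr rfl fun π _ => hlen π, Finset.sum_const, nsmul_eq_mul]
    _ = ∑ x ∈ Zn.image code, ∏ κ, (t⁻¹) ^ (x.2 κ).1 := by
        rw [Finset.sum_image fun π _ π' _ e => hinj π π' e]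
    _ ≤ ∑ x ∈ B, ∏ κ, (t⁻¹) ^ (x.2 κ).1 :=
        Finset.sum_le_sum_of_subset_of_nonneg (Finset.image_subset_iff.2 hmem)
          fun x _ _ => Finset.prod_nonneg fun κ _ => pow_nonneg ht' _
    _ = ((W.card : ℝ) ^ Fintype.card ι) ^ 2 *
        (∑ σ ∈ upTo K n, (t⁻¹) ^ σ.1) ^ Fintype.card (ι → ZMod 2) := by
        have e : ∑ y ∈ Fintype.piFinset fun _ : ι → ZMod 2 => upTo K n, ∏ κ, (t⁻¹) ^ (y κ).1 =
            (∑ σ ∈ upTo K n, (t⁻¹) ^ σ.1) ^ Fintype.card (ι → ZMod 2) := by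
          have := Finset.prod_univ_sum (fun _ : ι → ZMod 2 => upTo K n)
            (fun _ σ => (t⁻¹) ^ σ.1)
          rw [Finset.prod_const, Finset.card_univ] at this
          convert this.symm
        rw [Finset.sum_product]
        dsimp only
        rw [e, Finset.sum_const, nsmul_eq_mul, Finset.card_product, Fintype.card_piFinset,
          Finset.prod_const, Finset.card_univ]
        push_cast; ring
    _ ≤ _ := by
        have hW' : (W.card : ℝ) ≤ ((2 * (n + 1) ^ N : ℕ) : ℝ) := by exact_mod_cast hW
        have : 0 ≤ ∑ σ ∈ upTo K n, (t⁻¹) ^ σ.1 :=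
          Finset.sum_nonneg fun σ _ => pow_nonneg ht' _
        gcongr

theorem eventually_poly_mul_pow_le (A : ℝ) (d : ℕ) {t t' : ℝ} (ht : 0 < t) (htt' : t < t') :
    ∀ᶠ n : ℕ in Filter.atTop, A * ((n : ℝ) + 1) ^ d * t ^ n ≤ t' ^ n := by
  have ht' : 0 < t' := ht.trans htt'
  have hr : |t / t'| < 1 := by
    rw [abs_of_pos (by positivity)]; exact (div_lt_one ht').2 htt'
  have h1 := (Filter.tendsto_add_atTop_iff_nat 1).2
    (tendsto_pow_const_mul_const_pow_of_abs_lt_one d hr)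
  have h2 := h1.const_mul (A * (t / t')⁻¹)
  rw [mul_zero] at h2
  filter_upwards [h2.eventually_le_const (show (0:ℝ) < 1 by norm_num)] with n hn
  have e : A * (t / t')⁻¹ * (((n + 1 : ℕ) : ℝ) ^ d * (t / t') ^ (n + 1)) =
      A * ((n : ℝ) + 1) ^ d * t ^ n / t' ^ n := by
    rw [pow_succ, div_pow]; push_cast; field_simp
  rw [e, div_le_one (by positivity)] at hn
  exact hn

/-- The polynomial factor is absorbed by passing from `t` to a slightly larger `t'`. -/
theorem growthRate_le_of_isBoundedMerge {ι : Type} [Finite ι] {N : ℕ} {Z K : Set FinPerm}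
    (h : IsBoundedMerge ι N Z K) : growthRate Z ≤ growthRate K := by
  classical
  have := Fintype.ofFinite ι
  refine le_of_forall_gt fun s hs => ?_
  obtain ⟨t, hKt, hts⟩ := ENNReal.lt_iff_exists_nnreal_btwn.1 hs
  obtain ⟨t', htt', hts'⟩ := ENNReal.lt_iff_exists_nnreal_btwn.1 hts
  have htt : (t : ℝ) < t' := by exact_mod_cast htt'
  have ht : 0 < (t : ℝ) := by
    have : (0 : ℝ≥0∞) < t := bot_le.trans_lt hKt
    exact_mod_cast this
  refine lt_of_le_of_lt ?_ hts'
  rw [← ENNReal.ofReal_coe_nnreal] at hKt ⊢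
  obtain ⟨C, hC0, hC⟩ := sum_upTo_le ht (eventually_le_of_growthRate_lt hKt)
  refine growthRate_le_of_eventually t'.2 ?_
  set J := Fintype.card (ι → ZMod 2)
  set I := Fintype.card ι
  filter_upwards [eventually_poly_mul_pow_le ((2 ^ I) ^ 2 * C ^ J) (N * I * 2 + J) ht htt]
    with n hn
  refine le_trans ?_ hn
  have h1 := levelCard_le_of_isBoundedMerge h t ht n
  rw [inv_pow, ← div_eq_mul_inv, div_le_iff₀ (by positivity)] at h1
  refine h1.trans ?_
  have h2 : (∑ σ ∈ upTo K n, ((t : ℝ)⁻¹) ^ σ.1) ^ J ≤ ((n + 1) * C) ^ J :=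
    pow_le_pow_left₀ (Finset.sum_nonneg fun σ _ => by positivity) (hC n) J
  calc _ ≤ (((2 * (n + 1) ^ N : ℕ) : ℝ) ^ I) ^ 2 * ((n + 1) * C) ^ J * (t : ℝ) ^ n := by gcongr
    _ = _ := by push_cast; rw [mul_pow _ C]; ring

/-! ### Permutations as point sets, patterns and articulation points -/

/-- The position of an element, as an integer. -/
def pos (π : FinPerm) (i : Fin π.1) : ℤ := ((i : ℕ) : ℤ)

/-- The value of an element, as an integer. -/
def val (π : FinPerm) (i : Fin π.1) : ℤ := ((π.2 i : ℕ) : ℤ)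

theorem pos_lt {π : FinPerm} {i j : Fin π.1} : pos π i < pos π j ↔ i < j := by
  simp [pos]

theorem val_lt {π : FinPerm} {i j : Fin π.1} : val π i < val π j ↔ π.2 i < π.2 j := by
  simp [val]

theorem pos_injective (π : FinPerm) : Function.Injective (pos π) := fun i j h => by
  simpa [pos, Fin.ext_iff] using h

theorem val_injective (π : FinPerm) : Function.Injective (val π) := fun i j h => by
  simpa [val, ← Fin.ext_iff] using h

theorem involves_iff {α π : FinPerm} :
    Involves α π ↔ ∃ f, IsPatternEmb (pos α) (val α) (pos π) (val π) f := by
  constructor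
  · rintro ⟨f, hf⟩
    exact ⟨f, fun i j => ⟨fun h => pos_lt.2 (f.lt_iff_lt.2 (pos_lt.1 h)),
      fun h => val_lt.2 ((hf i j).1 (val_lt.1 h))⟩⟩
  · rintro ⟨f, hf⟩
    have hm : StrictMono f := fun i j h => pos_lt.1 ((hf i j).1 (pos_lt.2 h))
    refine ⟨OrderEmbedding.ofStrictMono f hm, fun i j => ?_⟩
    have key : ∀ i j, α.2 i < α.2 j → π.2 (f i) < π.2 (f j) := fun i j h =>
      val_lt.1 ((hf i j).2 (val_lt.2 h))
    refine ⟨key i j, fun h => ?_⟩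
    by_contra hn
    rcases (not_lt.1 hn).lt_or_eq with h1 | h1
    · exact lt_asymm h (key j i h1)
    · rw [α.2.injective h1] at h
      exact lt_irrefl _ h

theorem Involves.trans {α β γ : FinPerm} : Involves α β → Involves β γ → Involves α γ := by
  rintro ⟨f, hf⟩ ⟨g, hg⟩
  exact ⟨f.trans g, fun i j => (hf i j).trans (hg _ _)⟩

theorem patternOn_involves (π : FinPerm) (S : Finset (Fin π.1)) : Involves (patternOn π S) π :=
  ⟨S.orderEmbOfFin rfl, patternOn_lt_iff π S⟩

theorem Av.of_involves {B : Set FinPerm} {α π : FinPerm} (hπ : π ∈ Av B) (h : Involves α π) :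
    α ∈ Av B :=
  fun β hβ hα => hπ β hβ (hα.trans h)

theorem strictMono_fin_eq_id {n : ℕ} {f : Fin n → Fin n} (hf : StrictMono f) : f = id :=
  (hf.range_inj strictMono_id).1 (by
    rw [Set.range_id, (Finite.injective_iff_surjective.1 hf.injective).range_eq])

theorem Involves.eq_of_length_eq {α β : FinPerm} (h : Involves α β) (hn : α.1 = β.1) : α = β := by
  obtain ⟨n, a⟩ := α
  obtain ⟨m, b⟩ := β
  obtain rfl : n = m := hn
  obtain ⟨f, hf⟩ := h
  have hid : (f : Fin n → Fin n) = id := strictMono_fin_eq_id f.strictMono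
  have h2 : StrictMono fun x => b (a.symm x) := by
    intro x y hxy
    have := (hf (a.symm x) (a.symm y)).1 (by simpa using hxy)
    simpa [hid] using this
  have h3 := strictMono_fin_eq_id h2
  congr 1
  ext i
  have := congrFun h3 (a i)
  simp at this
  simp [this]

theorem length_patternOn (π : FinPerm) (S : Finset (Fin π.1)) : (patternOn π S).1 = S.card := rfl

/-- The element of `π` which gives a prescribed element of the pattern of `S`. -/
noncomputable def patternEmb (π : FinPerm) (S : Finset (Fin π.1)) :
    Fin (patternOn π S).1 ↪o Fin π.1 := S.orderEmbOfFin rfl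

theorem patternEmb_mem (π : FinPerm) (S : Finset (Fin π.1)) (j : Fin (patternOn π S).1) :
    patternEmb π S j ∈ S := Finset.orderEmbOfFin_mem S rfl j

theorem patternEmb_val_lt (π : FinPerm) (S : Finset (Fin π.1)) (i j : Fin (patternOn π S).1) :
    (patternOn π S).2 i < (patternOn π S).2 j ↔
      π.2 (patternEmb π S i) < π.2 (patternEmb π S j) := patternOn_lt_iff π S i j

/-- The position, within the pattern of `S`, of an element of `S`. -/
noncomputable def rank (π : FinPerm) (S : Finset (Fin π.1)) (x : S) : Fin (patternOn π S).1 :=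
  (S.orderIsoOfFin rfl).symm x

theorem patternEmb_rank (π : FinPerm) (S : Finset (Fin π.1)) (x : S) :
    patternEmb π S (rank π S x) = x :=
  congrArg Subtype.val ((S.orderIsoOfFin rfl).apply_symm_apply x)

theorem isPatternEmb_patternEmb (π : FinPerm) (S : Finset (Fin π.1)) :
    IsPatternEmb (pos (patternOn π S)) (val (patternOn π S)) (pos π) (val π) (patternEmb π S) :=
  fun i j => ⟨fun h => pos_lt.2 ((patternEmb π S).lt_iff_lt.2 (pos_lt.1 h)),
    fun h => val_lt.2 ((patternEmb_val_lt π S i j).1 (val_lt.1 h))⟩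

theorem isPatternEmb_rank (π : FinPerm) (S : Finset (Fin π.1)) :
    IsPatternEmb (fun x : S => pos π x) (fun x : S => val π x)
      (pos (patternOn π S)) (val (patternOn π S)) (rank π S) := by
  refine fun x y => ⟨fun h => pos_lt.2 ((patternEmb π S).lt_iff_lt.1 ?_),
    fun h => val_lt.2 ((patternEmb_val_lt π S _ _).2 ?_)⟩
  · rw [patternEmb_rank, patternEmb_rank]
    exact pos_lt.1 h
  · rw [patternEmb_rank, patternEmb_rank]
    exact val_lt.1 h

theorem IsPatternEmb.comp {X Y Z : Type*} {pX vX : X → ℤ} {pY vY : Y → ℤ} {pZ vZ : Z → ℤ}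
    {g : Y → Z} {f : X → Y} (hg : IsPatternEmb pY vY pZ vZ g) (hf : IsPatternEmb pX vX pY vY f) :
    IsPatternEmb pX vX pZ vZ fun x => g (f x) :=
  fun a b => ⟨fun h => (hg _ _).1 ((hf a b).1 h), fun h => (hg _ _).2 ((hf a b).2 h)⟩

theorem involves_patternOn {α π : FinPerm} {S : Finset (Fin π.1)} {f : Fin α.1 → Fin π.1}
    (hf : IsPatternEmb (pos α) (val α) (pos π) (val π) f) (hS : ∀ a, f a ∈ S) :
    Involves α (patternOn π S) :=
  involves_iff.2 ⟨fun a => rank π S ⟨f a, hS a⟩,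
    fun a b => ⟨fun h => (isPatternEmb_rank π S _ _).1 ((hf a b).1 h),
      fun h => (isPatternEmb_rank π S _ _).2 ((hf a b).2 h)⟩⟩

theorem patternOn_eq_patternOn {σ π : FinPerm} {T : Finset (Fin σ.1)} {S : Finset (Fin π.1)}
    {g : Fin σ.1 → Fin π.1} (hg : IsPatternEmb (pos σ) (val σ) (pos π) (val π) g)
    (hgi : Function.Injective g) (hS : S = T.image g) : patternOn σ T = patternOn π S := by
  refine Involves.eq_of_length_eq
    (involves_patternOn (hg.comp (isPatternEmb_patternEmb σ T)) fun a => ?_) ?_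
  · rw [hS]
    exact Finset.mem_image_of_mem _ (patternEmb_mem _ _ _)
  · rw [length_patternOn, length_patternOn, hS, Finset.card_image_of_injective _ hgi]

/-- The deleted point forms no inversion, so restoring it never violates the condition at another
point. -/
theorem isArticulationPoint_patternOn_compl {π : FinPerm} {i : Fin π.1}
    (hi : IsArticulationPoint π i) (j : Fin (patternOn π {i}ᶜ).1) :
    IsArticulationPoint (patternOn π {i}ᶜ) j ↔
      IsArticulationPoint π (patternEmb π {i}ᶜ j) := by
  set e := patternEmb π {i}ᶜ
  have hne : ∀ k, e k ≠ i := fun k => by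
    have := patternEmb_mem π {i}ᶜ k
    rwa [Finset.mem_compl, Finset.mem_singleton] at this
  constructor
  · intro h x
    by_cases hx : x = i
    · subst hx
      exact ⟨(hi (e j)).2, (hi (e j)).1⟩
    · have hmem : x ∈ ({i}ᶜ : Finset (Fin π.1)) := by simpa using hx
      obtain ⟨k, rfl⟩ : ∃ k, e k = x := ⟨_, patternEmb_rank π _ ⟨x, hmem⟩⟩
      have := h k
      exact ⟨fun hlt => (patternEmb_val_lt π _ _ _).1 (this.1 (e.lt_iff_lt.1 hlt)),
        fun hlt => (patternEmb_val_lt π _ _ _).1 (this.2 (e.lt_iff_lt.1 hlt))⟩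
  · intro h k
    exact ⟨fun hlt => (patternEmb_val_lt π _ _ _).2 ((h (e k)).1 (e.lt_iff_lt.2 hlt)),
      fun hlt => (patternEmb_val_lt π _ _ _).2 ((h (e k)).2 (e.lt_iff_lt.2 hlt))⟩

theorem red_patternOn_compl {π : FinPerm} {i : Fin π.1} (hi : IsArticulationPoint π i) :
    red (patternOn π {i}ᶜ) = red π := by
  refine patternOn_eq_patternOn (isPatternEmb_patternEmb π {i}ᶜ)
    (patternEmb π {i}ᶜ).injective (Finset.ext fun x => ?_)
  rw [Finset.mem_image]
  simp only [Finset.mem_filter, Finset.mem_univ, true_and]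
  constructor
  · intro hx
    have hmem : x ∈ ({i}ᶜ : Finset (Fin π.1)) := by
      simp only [Finset.mem_compl, Finset.mem_singleton]
      rintro rfl
      exact hx hi
    refine ⟨rank π _ ⟨x, hmem⟩, ?_, patternEmb_rank π _ ⟨x, hmem⟩⟩
    rw [isArticulationPoint_patternOn_compl hi, patternEmb_rank]
    exact hx
  · rintro ⟨j, hj, rfl⟩
    rwa [isArticulationPoint_patternOn_compl hi] at hj

theorem red_eq_self {π : FinPerm} (h : ∀ i, ¬ IsArticulationPoint π i) : red π = π := by
  refine (patternOn_involves π _).eq_of_length_eq ?_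
  rw [length_patternOn, Finset.filter_true_of_mem fun i _ => h i]
  simp

theorem ArticulationEquiv.red_eq {π σ : FinPerm} (h : ArticulationEquiv π σ) :
    red π = red σ := by
  induction h with
  | rel π σ h =>
    obtain ⟨i, hi, rfl⟩ := h
    exact (red_patternOn_compl hi).symm
  | refl => rfl
  | symm _ _ _ ih => exact ih.symm
  | trans _ _ _ _ _ ih₁ ih₂ => exact ih₁.trans ih₂

theorem isPatternEmb_decreasing_three {π : FinPerm} {x y z : Fin π.1} (hxy : pos π x < pos π y)
    (hyz : pos π y < pos π z) (hzy : val π z < val π y) (hyx : val π y < val π x) :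
    IsPatternEmb (pos (decreasing 3)) (val (decreasing 3)) (pos π) (val π) ![x, y, z] := by
  have hxz := hxy.trans hyz
  have hzx := hzy.trans hyx
  intro a b
  rw [pos_lt, val_lt, show (decreasing 3).2 a < (decreasing 3).2 b ↔ b < a from Fin.rev_lt_rev]
  change Fin 3 at a b
  fin_cases a <;> fin_cases b <;> simp_all [decreasing]

theorem noDecreasingTriple_of_mem_Av {π : FinPerm} (h : π ∈ Av {decreasing 3}) :
    NoDecreasingTriple (pos π) (val π) := fun _ _ _ h1 h2 h3 h4 =>
  h _ rfl (involves_iff.2 ⟨_, isPatternEmb_decreasing_three h1 h2 h3 h4⟩)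

theorem IsArticulationPoint.isCutPoint {π : FinPerm} {i : Fin π.1}
    (h : IsArticulationPoint π i) : IsCutPoint (pos π) (val π) i := fun j =>
  ⟨fun hj => val_lt.2 ((h j).1 (pos_lt.1 hj)), fun hj => val_lt.2 ((h j).2 (pos_lt.1 hj))⟩

/-! ### Replacing basis elements by their reductions -/

/-- An articulation point takes part in no inversion, hence in no occurrence of 321. -/
theorem decreasing_three_involves_patternOn_compl {β : FinPerm} {i : Fin β.1}
    (hi : IsArticulationPoint β i) (h : ¬ NoDecreasingTriple (pos β) (val β)) :
    Involves (decreasing 3) (patternOn β {i}ᶜ) := by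
  simp only [NoDecreasingTriple, not_forall] at h
  obtain ⟨x, y, z, h1, h2, h3, h4, -⟩ := h
  have hc := hi.isCutPoint
  refine involves_patternOn (isPatternEmb_decreasing_three h1 h2 h3 h4) fun a => ?_
  simp only [Finset.mem_compl, Finset.mem_singleton]
  change Fin 3 at a
  fin_cases a
  · rintro rfl
    exact lt_asymm h4 ((hc y).2 h1)
  · rintro rfl
    exact lt_asymm h4 ((hc x).1 h1)
  · rintro rfl
    exact lt_asymm h3 ((hc y).1 h2)

theorem isBoundedMerge_of_isArticulationPoint {β : FinPerm} {i : Fin β.1}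
    (hi : IsArticulationPoint β i) (hβ : NoDecreasingTriple (pos β) (val β)) (C : Set FinPerm) :
    ∃ (ι : Type) (_ : Finite ι) (N : ℕ),
      IsBoundedMerge ι N (Av {decreasing 3} ∩ Av (insert β C))
        (Av {decreasing 3} ∩ Av (insert (patternOn β {i}ᶜ) C)) := by
  obtain ⟨ι, hι, N, h⟩ := exists_coloring (pos_injective β) (val_injective β) hβ hi.isCutPoint
  refine ⟨ι, hι, N, fun π hπ => ?_⟩
  obtain ⟨col, htame, hsplit⟩ := h (Fin π.1) (pos π) (val π) (pos_injective π) (val_injective π)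
    (noDecreasingTriple_of_mem_Av hπ.1) fun f hf =>
      hπ.2 β (Set.mem_insert _ _) (involves_iff.2 ⟨f, hf⟩)
  refine ⟨fun x r => col r x, htame, fun κ S hS => ?_⟩
  rcases hsplit κ with hsub | hno
  · refine Or.inr (Finset.card_le_one.2 fun x hx y hy => hsub ?_ ?_)
    · exact fun r => congrFun ((hS x).1 hx) r
    · exact fun r => congrFun ((hS y).1 hy) r
  · refine Or.inl ⟨Av.of_involves hπ.1 (patternOn_involves π S), ?_⟩
    rintro γ (rfl | hγ) hinv
    · obtain ⟨f, hf⟩ := involves_iff.1 hinv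
      have hf' := (isPatternEmb_patternEmb π S).comp hf
      let inc : {a // a ≠ i} → ({i}ᶜ : Finset (Fin β.1)) := fun a => ⟨a, by simpa using a.2⟩
      refine hno _ (hf'.comp fun a b => isPatternEmb_rank β {i}ᶜ (inc a) (inc b)) fun a r => ?_
      exact congrFun ((hS _).1 (patternEmb_mem π S _)) r
    · exact hπ.2 γ (Set.mem_insert_of_mem _ hγ) (hinv.trans (patternOn_involves π S))

theorem growthRate_insert_patternOn_compl {β : FinPerm} {i : Fin β.1}
    (hi : IsArticulationPoint β i) (C : Set FinPerm) :
    growthRate (Av {decreasing 3} ∩ Av (insert β C)) =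
      growthRate (Av {decreasing 3} ∩ Av (insert (patternOn β {i}ᶜ) C)) := by
  apply le_antisymm
  · by_cases hβ : NoDecreasingTriple (pos β) (val β)
    · obtain ⟨ι, _, N, h⟩ := isBoundedMerge_of_isArticulationPoint hi hβ C
      exact growthRate_le_of_isBoundedMerge h
    · refine growthRate_mono fun π hπ => ⟨hπ.1, ?_⟩
      rintro γ (rfl | hγ) hinv
      · exact hπ.1 _ rfl ((decreasing_three_involves_patternOn_compl hi hβ).trans hinv)
      · exact hπ.2 γ (Set.mem_insert_of_mem _ hγ) hinv
  · refine growthRate_mono fun π hπ => ⟨hπ.1, ?_⟩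
    rintro γ (rfl | hγ) hinv
    · exact hπ.2 _ (Set.mem_insert _ _) ((patternOn_involves γ _).trans hinv)
    · exact hπ.2 γ (Set.mem_insert_of_mem _ hγ) hinv

theorem growthRate_insert_red (β : FinPerm) (C : Set FinPerm) :
    growthRate (Av {decreasing 3} ∩ Av (insert β C)) =
      growthRate (Av {decreasing 3} ∩ Av (insert (red β) C)) := by
  induction hn : β.1 using Nat.strong_induction_on generalizing β with
  | _ n ih =>
    by_cases h : ∃ i, IsArticulationPoint β i
    · obtain ⟨i, hi⟩ := h
      rw [growthRate_insert_patternOn_compl hi, ih _ ?_ (patternOn β {i}ᶜ) rfl,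
        red_patternOn_compl hi]
      have := i.2
      rw [length_patternOn, Finset.card_compl, Finset.card_singleton, Fintype.card_fin]
      omega
    · rw [red_eq_self (not_exists.1 h)]

theorem growthRate_red_image {X : Set FinPerm} (hX : X.Finite) :
    growthRate (Av {decreasing 3} ∩ Av X) = growthRate (Av {decreasing 3} ∩ Av (red '' X)) := by
  -- The arbitrary `Z` collects the elements already replaced, so that they can be treated one at a
  -- time.
  suffices h : ∀ Z, growthRate (Av {decreasing 3} ∩ Av (X ∪ Z)) =
      growthRate (Av {decreasing 3} ∩ Av (red '' X ∪ Z)) by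
    simpa using h ∅
  induction X, hX using Set.Finite.induction_on with
  | empty => simp
  | @insert a X _ _ ih =>
    intro Z
    rw [Set.insert_union, growthRate_insert_red, ← Set.union_insert, ih, Set.image_insert_eq,
      Set.insert_union, Set.union_insert]

theorem red_image_eq {X Y : Set FinPerm} (hXY : ∀ π ∈ X, ∃ σ ∈ Y, ArticulationEquiv π σ)
    (hYX : ∀ σ ∈ Y, ∃ π ∈ X, ArticulationEquiv π σ) : red '' X = red '' Y := by
  apply Set.Subset.antisymm
  · rintro _ ⟨π, hπ, rfl⟩
    obtain ⟨σ, hσ, h⟩ := hXY π hπ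
    exact ⟨σ, hσ, h.red_eq.symm⟩
  · rintro _ ⟨σ, hσ, rfl⟩
    obtain ⟨π, hπ, h⟩ := hYX σ hσ
    exact ⟨π, hπ, h.red_eq⟩

end PermPattern

theorem theorem3p1 :
    (∀ X : Set PermPattern.FinPerm, X.Finite →
      PermPattern.growthRate
          (PermPattern.Av {PermPattern.decreasing 3} ∩ PermPattern.Av X) =
        PermPattern.growthRate
          (PermPattern.Av {PermPattern.decreasing 3} ∩
            PermPattern.Av (PermPattern.red '' X))) ∧
    (∀ X Y : Set PermPattern.FinPerm, X.Finite → Y.Finite →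
      (∀ π ∈ X, ∃ σ ∈ Y, PermPattern.ArticulationEquiv π σ) →
      (∀ σ ∈ Y, ∃ π ∈ X, PermPattern.ArticulationEquiv π σ) →
      PermPattern.growthRate
          (PermPattern.Av {PermPattern.decreasing 3} ∩ PermPattern.Av X) =
        PermPattern.growthRate
          (PermPattern.Av {PermPattern.decreasing 3} ∩ PermPattern.Av Y)) := by
  refine ⟨fun X hX => PermPattern.growthRate_red_image hX, fun X Y hX hY hXY hYX => ?_⟩
  rw [PermPattern.growthRate_red_image hX, PermPattern.red_image_eq hXY hYX,
    ← PermPattern.growthRate_red_image hY]
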